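/- For a finite group $G$, let $\mathbf Z(G)$ be its center, $\operatorname{Irr}(G)$ its set of irreducible complex characters, $\mathbf F(G)$ its Fitting subgroup and $\mathbf F_2(G)$ the subgroup with $\mathbf F_2(G)/\mathbf F(G)=\mathbf F(G/\mathbf F(G))$. Let $\mathbf Q_8$ and $D_8$ be the quaternion and dihedral groups of order $8$, and let $$\widetilde{\operatorname{GL}}(2,3)=\langle x,y,z\mid x^8=1,\ y^2=x^4,\ z^3=1,\ x^y=x^{-1},\ z^x=x^2yz^{-1},\ (x^2)^z=y\rangle ,\qquad a^b=bab^{-1}.$$ Proposition. In each of the cases (i)–(v) below, and for each of the two alternatives in (i) and in (ii), there exist a finite solvable group $G$, a faithful character $\chi\in\operatorname{Irr}(G)$, a character $\alpha\in\operatorname{Irr}(G)$, a positive integer $m$ and a chief factor $E/Z$ of $G$, where $Z=\mathbf Z(G)$, such that, writing $\bar G=G/E$, $$\chi\overline{\chi}=1_G+m\alpha,\qquad m=1,\qquad \chi(1)^2=|E:Z|,$$ and the conditions of that case hold: (i) $\chi(1)=2$ and $G/Z\cong A_4$; respectively $\chi(1)=2$ and $G/Z\cong S_4$. (ii) $\chi(1)=3$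 and $\bar G\cong\mathbf Q_8$; respectively $\chi(1)=3$ and $\bar G\cong\operatorname{SL}(2,3)$. (iii) $\chi(1)=5$ and $\bar G\cong\operatorname{SL}(2,3)$. (iv) $\chi(1)=7$ and $\bar G\cong\widetilde{\operatorname{GL}}(2,3)$. (v) $\chi(1)=9$, $\mathbf F(\bar G)$ is an extra-special group of order $2^5$, namely the central product of $\mathbf Q_8$ and $D_8$ with amalgamated centers, $|\mathbf F_2(\bar G)/\mathbf F(\bar G)|=5$, and $\bar G/\mathbf F_2(\bar G)$ is isomorphic to a subgroup of the cyclic group of order $2$. -/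

import Mathlib

/-- `χ : G → ℂ` is an irreducible complex character of `G`, i.e. `χ ∈ Irr(G)`. -/
def IsIrrChar {G : Type*} [Group G] (χ : G → ℂ) : Prop :=
  ∃ (n : ℕ) (ρ : Representation ℂ G (Fin n → ℂ)), ρ.IsIrreducible ∧ ρ.character = χ

/-- A character `χ` is faithful if its kernel `{g | χ g = χ 1}` is trivial. -/
def IsFaithfulChar {G : Type*} [Group G] (χ : G → ℂ) : Prop :=
  ∀ g : G, χ g = χ 1 → g = 1

/-- `L / K` is a chief factor of `G`: `K < L` are normal in `G` and no normal subgroup of `G`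
lies strictly between them. -/
structure IsChiefFactor {G : Type*} [Group G] (K L : Subgroup G) : Prop where
  normal_bot : K.Normal
  normal_top : L.Normal
  lt : K < L
  eq_or_eq : ∀ N : Subgroup G, N.Normal → K ≤ N → N ≤ L → N = K ∨ N = L

/-- The group with generators `x, y, z` and relations `x^8 = 1`, `y^2 = x^4`, `z^3 = 1`,
`x^y = x⁻¹`, `z^x = x^2 y z⁻¹`, `(x^2)^z = y`, where `a^b = b a b⁻¹`. -/
def TwistedGL23.rels : Set (FreeGroup (Fin 3)) :=
  let x := FreeGroup.of (0 : Fin 3)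
  let y := FreeGroup.of (1 : Fin 3)
  let z := FreeGroup.of (2 : Fin 3)
  {x ^ 8,
    y ^ 2 * (x ^ 4)⁻¹,
    z ^ 3,
    (y * x * y⁻¹) * (x⁻¹)⁻¹,
    (x * z * x⁻¹) * (x ^ 2 * y * z⁻¹)⁻¹,
    (z * x ^ 2 * z⁻¹) * y⁻¹}

/-- The twisted form (isoclinic group) of `GL(2,3)`, by its presentation. -/
abbrev TwistedGL23 : Type := PresentedGroup TwistedGL23.rels

/-- The Fitting subgroup `F(G)`: the subgroup generated by all normal nilpotent subgroups. -/
def fittingSubgroup (G : Type*) [Group G] : Subgroup G :=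
  sSup {N : Subgroup G | N.Normal ∧ Group.IsNilpotent N}

instance fittingSubgroup_normal (G : Type*) [Group G] : (fittingSubgroup G).Normal := by
  unfold fittingSubgroup
  rw [sSup_eq_iSup']
  have : ∀ N : {N : Subgroup G | N.Normal ∧ Group.IsNilpotent N}, (N : Subgroup G).Normal :=
    fun N => N.2.1
  infer_instance

/-- The second Fitting subgroup `F₂(G)`: the preimage in `G` of the Fitting subgroup of
`G / F(G)`. -/
def secondFittingSubgroup (G : Type*) [Group G] : Subgroup G :=
  (fittingSubgroup (G ⧸ fittingSubgroup G)).comap (QuotientGroup.mk' (fittingSubgroup G))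

instance secondFittingSubgroup_normal (G : Type*) [Group G] :
    (secondFittingSubgroup G).Normal := by
  unfold secondFittingSubgroup
  infer_instance

/-- `P` is an extra-special `p`-group: `Z(P) = P' = Φ(P)` has order `p`. -/
structure IsExtraspecial (p : ℕ) (P : Type*) [Group P] : Prop where
  isPGroup : IsPGroup p P
  card_center : Nat.card (Subgroup.center P) = p
  commutator_eq : commutator P = Subgroup.center P
  frattini_eq : frattini P = Subgroup.center P

/-- `P` is the central product of a copy `A` of `H` and a copy `B` of `K`, with the centers of
`A` and `B` amalgamated. -/
def IsCentralProductOf (P H K : Type*) [Group P] [Group H] [Group K] : Prop :=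
  ∃ A B : Subgroup P, Nonempty (A ≃* H) ∧ Nonempty (B ≃* K) ∧
    (∀ a ∈ A, ∀ b ∈ B, a * b = b * a) ∧ A ⊔ B = ⊤ ∧
    A ⊓ B = (Subgroup.center A).map A.subtype ∧ A ⊓ B = (Subgroup.center B).map B.subtype

/-- `G` is a solvable group with a faithful `χ ∈ Irr(G)` and `α ∈ Irr(G)` such that
`χ χ̄ = 1_G + m α` with `m > 0`, and `E / Z(G)` is a chief factor of `G`. -/
structure IsOneConstituentSetup (G : Type*) [Group G] (χ α : G → ℂ) (m : ℕ)
    (E : Subgroup G) : Prop where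
  solvable : Group.IsSolvable G
  irr : IsIrrChar χ
  faithful : IsFaithfulChar χ
  irr_constituent : IsIrrChar α
  mult_pos : 0 < m
  mul_conj : ∀ g : G, χ g * starRingEnd ℂ (χ g) = 1 + (m : ℂ) * α g
  chief : IsChiefFactor (Subgroup.center G) E

/-- Some finite solvable group `G`, with characters `χ, α` and a chief factor `E / Z(G)` as in
`IsOneConstituentSetup`, has `m = 1`, `χ(1)^2 = |E : Z(G)|`, `χ(1) = d` and satisfies the
condition `C G E`. -/
def IsRealized (d : ℕ)
    (C : (G : Type) → [Group G] → (E : Subgroup G) → [E.Normal] → Prop) : Prop :=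
  ∃ (G : Type) (_ : Group G) (_ : Finite G) (χ α : G → ℂ) (m : ℕ) (E : Subgroup G)
    (_ : E.Normal), IsOneConstituentSetup G χ α m E ∧ m = 1 ∧
      χ 1 ^ 2 = ((Subgroup.center G).relIndex E : ℂ) ∧ χ 1 = (d : ℂ) ∧ C G E

/-- The structure of `H = G / E` in the case `χ(1) = 9`. -/
structure IsDegreeNineQuotient (H : Type*) [Group H] : Prop where
  card_fitting : Nat.card (fittingSubgroup H) = 2 ^ 5
  extraspecial : IsExtraspecial 2 (fittingSubgroup H)
  centralProduct :
    IsCentralProductOf (fittingSubgroup H) (QuaternionGroup 2) (DihedralGroup 4)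
  index_fitting : (fittingSubgroup H).relIndex (secondFittingSubgroup H) = 5
  embeds : ∃ f : H ⧸ secondFittingSubgroup H →* Multiplicative (ZMod 2), Function.Injective f

/-!
All seven groups arise in the same way. A Weyl system on a finite abelian group `V` of order `d²`
is a family of unitary matrices `P v` of size `d`, indexed by `V`, that form a projective
representation and are traceless for `v ≠ 0`; hence they are a basis of all matrices. Let `H` be a
solvable group acting faithfully on `V` such that every `h ∈ H` is induced, up to scalars, by
conjugation with a unitary matrix `U`. The pairs `(U, h)` with `det U = 1` form a finite solvable
group `G` (`IsWeylSystem.liftGroup`). Its center `Z` consists of the scalars, the kernel `E` of the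
projection to `H` consists of the Weyl operators up to scalars, so `|E : Z| = |V| = d²` and
`G / E ≅ H`. The character `χ(U, h) = tr U` is faithful and irreducible of degree `d`, and `χ χ̄` is
the character of the conjugation action on all matrices, that is `1_G + α` with `α` the character on
the traceless matrices. If `H` is transitive on `V ∖ {0}`, then it permutes the lines spanned by
the `P v`, `v ≠ 0`, transitively, and averaging over the Weyl operators isolates these lines inside
any invariant subspace; so `α` is irreducible. For the same reason `E / Z` is a chief factor. This
is `isRealized_of_isWeylSystem`.

It remains to find `V` and `H`. For odd `d` take `V = R²` with `R` a commutative ring of order `d`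
in which `2` is invertible, and the shift and modulation operators on functions on `R`, normalised
so that the cocycle depends on the determinant form only (`isWeylSystem_weylOp`). A map preserving
the cocycle gives an equivalent projective representation, so that it lifts to a unitary matrix
(`IsWeylSystem.exists_unitary_conj`, a finite Stone–von Neumann theorem).

* For `d = 3, 5, 7` and `R = 𝔽_d`, the groups `Q₈`, `SL₂(3)`, and the twisted form of `GL(2,3)`
  embed in `SL₂(d)`, transitively on nonzero vectors. For the last one, given by a presentation, a
  normal form shows that its order is at most `48`; being transitive on the `48` nonzero vectors of
  `𝔽₇²` it acts regularly, and hence faithfully.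
* For `d = 9`, `R = 𝔽₃ × 𝔽₃`, the group `H` of order `160` is an extraspecial group of order `2⁵`
  extended by a cyclic group of order five. The extraspecial group is realised by the signed even
  monomials in a Clifford algebra on five generators, permuted cyclically. Its spin representation
  of degree four over `𝔽₃` is symplectic and extends to `H`, which is transitive on the `80` nonzero
  vectors.
* For `d = 2` the Weyl system is that of the Pauli matrices, and `H` is the cyclic group of order
  three or all of `SL₂(2)`. Here `G` acts with kernel `Z` on the four conjugates, up to sign, of
  the sum of the three Pauli matrices, which are the main diagonals of a cube, and the order of
  `G / Z` identifies it with `A₄` or `S₄`.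
-/

/-! ### Characters and traces -/

/-- The character of an irreducible representation on any finite-dimensional complex space is an
irreducible character. -/
theorem IsIrrChar.of_isIrreducible {G W : Type*} [Group G] [AddCommGroup W] [Module ℂ W]
    [FiniteDimensional ℂ W] (ρ : Representation ℂ G W) (hρ : ρ.IsIrreducible) :
    IsIrrChar ρ.character := by
  let e : W ≃ₗ[ℂ] (Fin (Module.finrank ℂ W) → ℂ) := (Module.finBasis ℂ W).equivFun
  let σ : Representation ℂ G (Fin (Module.finrank ℂ W) → ℂ) :=
    (e.conjAlgEquiv ℂ : Module.End ℂ W →* _).comp ρ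
  have hσ : ∀ g w, σ g (e w) = e (ρ g w) := fun g w => by simp [σ, LinearEquiv.conjAlgEquiv]
  refine ⟨_, σ, ?_, ?_⟩
  · let o : Subrepresentation ρ ≃o Subrepresentation σ :=
      { toFun := fun S => ⟨S.toSubmodule.map (e : W →ₗ[ℂ] _), by
          rintro g _ ⟨w, hw, rfl⟩
          exact ⟨ρ g w, S.apply_mem_toSubmodule g hw, (hσ g w).symm⟩⟩
        invFun := fun S => ⟨S.toSubmodule.comap (e : W →ₗ[ℂ] _), by
          intro g w hw
          have := S.apply_mem_toSubmodule g hw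
          simpa [hσ] using this⟩
        left_inv := fun S => by
          apply Subrepresentation.toSubmodule_injective
          exact Submodule.comap_map_eq_of_injective e.injective _
        right_inv := fun S => by
          apply Subrepresentation.toSubmodule_injective
          exact Submodule.map_comap_eq_of_surjective e.surjective _
        map_rel_iff' := fun {S T} =>
          Submodule.map_le_map_iff_of_injective e.injective S.toSubmodule T.toSubmodule }
    exact o.symm.isSimpleOrder_iff.mpr hρ
  · funext g
    change LinearMap.trace ℂ _ (σ g) = LinearMap.trace ℂ _ (ρ g)
    rw [← LinearMap.trace_conj' (ρ g) e]
    rfl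

/-- A representation is irreducible as soon as every nonzero invariant subspace is everything. -/
theorem Representation.isIrreducible_of_forall_eq_top {G W : Type*} [Group G] [AddCommGroup W]
    [Module ℂ W] [Nontrivial W] (ρ : Representation ℂ G W)
    (h : ∀ S : Submodule ℂ W, (∀ g, ∀ w ∈ S, ρ g w ∈ S) → S ≠ ⊥ → S = ⊤) :
    ρ.IsIrreducible := by
  have hnt : Nontrivial (Subrepresentation ρ) := by
    refine ⟨⊥, ⊤, fun hbt => ?_⟩
    have : (⊥ : Submodule ℂ W) = ⊤ := congrArg Subrepresentation.toSubmodule hbt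
    exact bot_ne_top this
  refine @IsSimpleOrder.mk _ _ _ hnt fun S => ?_
  by_cases hS : S.toSubmodule = ⊥
  · exact Or.inl (Subrepresentation.toSubmodule_injective hS)
  · exact Or.inr (Subrepresentation.toSubmodule_injective
      (h _ (fun g w hw => S.apply_mem_toSubmodule g hw) hS))

/-- The trace of `A ↦ U A V` on square matrices. -/
theorem Matrix.trace_mulLeft_mulRight {ι : Type*} [Fintype ι] [DecidableEq ι]
    (U V : Matrix ι ι ℂ) :
    LinearMap.trace ℂ (Matrix ι ι ℂ) (LinearMap.mulLeft ℂ U ∘ₗ LinearMap.mulRight ℂ V) =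
      U.trace * V.trace := by
  rw [LinearMap.trace_eq_matrix_trace ℂ (Matrix.stdBasis ℂ ι ι)]
  simp only [Matrix.trace, Matrix.diag_apply, LinearMap.toMatrix_apply, LinearMap.comp_apply,
    LinearMap.mulLeft_apply, LinearMap.mulRight_apply, Fintype.sum_prod_type,
    Matrix.stdBasis_eq_single, Finset.sum_mul_sum]
  refine Finset.sum_congr rfl fun i _ => Finset.sum_congr rfl fun j _ => ?_
  have : ∀ A : Matrix ι ι ℂ, (Matrix.stdBasis ℂ ι ι).repr A (i, j) = A i j := fun A => rfl
  rw [this, Matrix.mul_apply, Finset.sum_eq_single i]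
  · simp
  · intro b _ hb
    simp [hb]
  · simp

/-! ### Weyl systems -/

section

open Matrix

/-- A Weyl system (or nice error basis) on the finite abelian group `V`: unitary matrices `P v`,
`v ∈ V`, forming a projective representation with cocycle `κ`, traceless for `v ≠ 0`, and
`|V| = (degree)²` many. -/
structure IsWeylSystem {V ι : Type*} [AddCommGroup V] [Fintype V] [Fintype ι] [DecidableEq ι]
    (κ : V → V → ℂ) (P : V → Matrix ι ι ℂ) : Prop where
  mem_unitary : ∀ v, P v ∈ unitaryGroup ι ℂ
  zero : P 0 = 1
  mul : ∀ u v, P u * P v = κ u v • P (u + v)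
  star_cocycle_mul : ∀ u v, κ u v * star (κ u v) = 1
  trace_eq_zero : ∀ v, v ≠ 0 → (P v).trace = 0
  card_eq : Fintype.card V = Fintype.card ι ^ 2

namespace IsWeylSystem

variable {V ι : Type*} [AddCommGroup V] [Fintype V] [Fintype ι] [DecidableEq ι]
  {κ : V → V → ℂ} {P : V → Matrix ι ι ℂ} (hP : IsWeylSystem κ P)
include hP

theorem star_mul_self (v : V) : star (P v) * P v = 1 := (hP.mem_unitary v).1

theorem mul_star_self (v : V) : P v * star (P v) = 1 := (hP.mem_unitary v).2

theorem card_pos : 0 < Fintype.card ι := by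
  rcases Nat.eq_zero_or_pos (Fintype.card ι) with h | h
  · have := hP.card_eq
    rw [h] at this
    exact absurd this Fintype.card_ne_zero
  · exact h

theorem nonempty : Nonempty ι := Fintype.card_pos_iff.mp hP.card_pos

theorem card_ne_zero : (Fintype.card ι : ℂ) ≠ 0 := Nat.cast_ne_zero.mpr hP.card_pos.ne'

theorem ne_zero (v : V) : P v ≠ 0 := by
  intro h
  have := hP.nonempty
  have h1 := hP.star_mul_self v
  rw [h, mul_zero] at h1
  exact zero_ne_one h1

theorem cocycle_ne_zero (u v : V) : κ u v ≠ 0 := fun h => by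
  simpa [h] using hP.star_cocycle_mul u v

theorem star_eq (v : V) : star (P v) = (κ (-v) v)⁻¹ • P (-v) := by
  have h := hP.mul (-v) v
  rw [neg_add_cancel, hP.zero] at h
  have h2 : P (-v) = κ (-v) v • star (P v) := by
    calc P (-v) = P (-v) * (P v * star (P v)) := by rw [hP.mul_star_self, mul_one]
      _ = κ (-v) v • star (P v) := by rw [← mul_assoc, h, smul_mul_assoc, one_mul]
  rw [h2, smul_smul, inv_mul_cancel₀ (hP.cocycle_ne_zero _ _), one_smul]

theorem trace_star_mul {u v : V} (h : u ≠ v) : (star (P u) * P v).trace = 0 := by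
  rw [hP.star_eq, smul_mul_assoc, hP.mul, trace_smul, trace_smul, hP.trace_eq_zero, smul_zero,
    smul_zero]
  rwa [neg_add_eq_sub, sub_ne_zero, ne_comm]

theorem trace_star_mul_sum (a : V → ℂ) (u : V) :
    (star (P u) * ∑ v, a v • P v).trace = a u * Fintype.card ι := by
  rw [Finset.mul_sum, trace_sum, Finset.sum_eq_single u]
  · rw [mul_smul_comm, trace_smul, hP.star_mul_self, trace_one, smul_eq_mul]
  · intro v _ hv
    rw [mul_smul_comm, trace_smul, hP.trace_star_mul hv.symm, smul_zero]
  · simp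

theorem linearIndependent : LinearIndependent ℂ P := by
  rw [Fintype.linearIndependent_iff]
  intro a ha u
  have h := hP.trace_star_mul_sum a u
  rw [ha, mul_zero, trace_zero] at h
  exact (mul_eq_zero.mp h.symm).resolve_right hP.card_ne_zero

theorem span_eq_top : Submodule.span ℂ (Set.range P) = ⊤ := by
  apply hP.linearIndependent.span_eq_top_of_card_eq_finrank'
  rw [Module.finrank_matrix, Module.finrank_self, hP.card_eq, sq, mul_one]

/-- Fourier expansion of a matrix in a Weyl system. -/
theorem eq_sum (A : Matrix ι ι ℂ) :
    A = ∑ v, ((star (P v) * A).trace / Fintype.card ι) • P v := by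
  have hA : A ∈ Submodule.span ℂ (Set.range P) := by rw [hP.span_eq_top]; trivial
  obtain ⟨a, rfl⟩ := (Submodule.mem_span_range_iff_exists_fun ℂ).mp hA
  refine Finset.sum_congr rfl fun u _ => ?_
  rw [hP.trace_star_mul_sum, mul_div_cancel_right₀ _ hP.card_ne_zero]

theorem exists_trace_ne_zero {A : Matrix ι ι ℂ} (hA : A ≠ 0) :
    ∃ u, (star (P u) * A).trace ≠ 0 := by
  by_contra! h
  apply hA
  rw [hP.eq_sum A]
  exact Finset.sum_eq_zero fun v _ => by rw [h v, zero_div, zero_smul]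

theorem mem_of_forall_mem (S : Submodule ℂ (Matrix ι ι ℂ)) (h : ∀ v, P v ∈ S)
    (A : Matrix ι ι ℂ) : A ∈ S := by
  rw [hP.eq_sum A]
  exact S.sum_mem fun v _ => S.smul_mem _ (h v)

/-- A matrix commuting with the whole Weyl system is scalar. -/
theorem eq_smul_one_of_commute {X : Matrix ι ι ℂ} (h : ∀ v, P v * X = X * P v) :
    X = (X.trace / Fintype.card ι) • 1 := by
  have hall : ∀ A : Matrix ι ι ℂ, A * X = X * A := fun A => by
    rw [hP.eq_sum A, Finset.sum_mul, Finset.mul_sum]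
    exact Finset.sum_congr rfl fun v _ => by rw [smul_mul_assoc, mul_smul_comm, h]
  obtain ⟨c, hc⟩ := Matrix.mem_range_scalar_of_commute_single (M := X)
    fun i j _ => hall (Matrix.single i j 1)
  have hX : X = c • 1 := by rw [← hc, smul_one_eq_diagonal]; rfl
  rw [hX, trace_smul, trace_one, smul_eq_mul, mul_div_cancel_right₀ _ hP.card_ne_zero]

/-- Any two members of a Weyl system commute up to a scalar. -/
theorem exists_conj_eq (u v : V) : ∃ c : ℂ, P u * P v * star (P u) = c • P v := by
  refine ⟨κ u v * (κ v u)⁻¹, ?_⟩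
  have h : P (u + v) = (κ v u)⁻¹ • (P v * P u) := by
    rw [hP.mul, smul_smul, inv_mul_cancel₀ (hP.cocycle_ne_zero _ _), one_smul, add_comm]
  rw [hP.mul, h, smul_smul, smul_mul_assoc, mul_assoc, hP.mul_star_self, mul_one]

theorem eq_of_smul_eq {u v : V} {a b : ℂ} (ha : a ≠ 0) (h : a • P u = b • P v) : u = v := by
  by_contra huv
  have h1 := congrArg (fun X => (star (P u) * X).trace) h
  simp only [mul_smul_comm, trace_smul, hP.star_mul_self, hP.trace_star_mul huv,
    trace_one, smul_eq_mul, mul_zero] at h1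
  exact (mul_ne_zero ha hP.card_ne_zero) h1

/-- A nonzero matrix that every `P v` normalises up to scalars is a scalar multiple of a member of
the Weyl system. -/
theorem exists_eq_smul_of_conj {U : Matrix ι ι ℂ} (hU : U ≠ 0)
    (h : ∀ v, ∃ c : ℂ, P v * U * star (P v) = c • U) : ∃ (u : V) (a : ℂ), U = a • P u := by
  obtain ⟨u, hu⟩ := hP.exists_trace_ne_zero hU
  have hcomm : ∀ v, P v * (star (P u) * U) = (star (P u) * U) * P v := by
    intro v
    obtain ⟨c, hc⟩ := h v
    obtain ⟨b, hb⟩ := hP.exists_conj_eq v u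
    have hb' : P v * star (P u) * star (P v) = star b • star (P u) := by
      have := congrArg star hb
      simpa [mul_assoc] using this
    have key : P v * (star (P u) * U) * star (P v) = (star b * c) • (star (P u) * U) := by
      calc P v * (star (P u) * U) * star (P v)
          = (P v * star (P u) * star (P v)) * (P v * U * star (P v)) := by
            simp only [mul_assoc]
            rw [← mul_assoc (star (P v)) (P v), hP.star_mul_self, one_mul]
        _ = _ := by rw [hb', hc, smul_mul_smul_comm]
    -- Conjugation preserves the trace, and the trace is nonzero, so the scalar is `1`.
    have htr := congrArg trace key
    rw [trace_mul_comm, ← mul_assoc, hP.star_mul_self, one_mul, trace_smul, smul_eq_mul] at htr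
    have hone : star b * c = 1 := by
      have : (star b * c - 1) * (star (P u) * U).trace = 0 := by rw [sub_mul, ← htr]; ring
      exact sub_eq_zero.mp ((mul_eq_zero.mp this).resolve_right hu)
    rw [hone, one_smul] at key
    calc P v * (star (P u) * U) = P v * (star (P u) * U) * (star (P v) * P v) := by
          rw [hP.star_mul_self, mul_one]
      _ = _ := by rw [← mul_assoc, key]
  have hs := hP.eq_smul_one_of_commute hcomm
  refine ⟨u, (star (P u) * U).trace / Fintype.card ι, ?_⟩
  calc U = P u * (star (P u) * U) := by rw [← mul_assoc, hP.mul_star_self, one_mul]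
    _ = _ := by
      conv_lhs => rw [hs]
      rw [mul_smul_comm, mul_one]

/-- Any projective representation by unitary matrices with the same cocycle is unitarily
equivalent to the Weyl system. -/
theorem exists_unitary_conj {Q : V → Matrix ι ι ℂ} (hQ : ∀ v, Q v ∈ unitaryGroup ι ℂ)
    (hmul : ∀ u v, Q u * Q v = κ u v • Q (u + v)) :
    ∃ U ∈ unitaryGroup ι ℂ, ∀ v, U * P v * star U = Q v := by
  -- The averages `∑ Q w M P w⁻¹` intertwine; linear independence of `P` makes one nonzero.
  let T : Matrix ι ι ℂ → Matrix ι ι ℂ := fun M => ∑ w, Q w * M * star (P w)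
  have hT : ∀ M v, Q v * T M * star (P v) = T M := by
    intro M v
    simp only [T, Finset.mul_sum, Finset.sum_mul]
    refine Fintype.sum_equiv (Equiv.addLeft v) _ _ fun w => ?_
    have h1 : star (P w) * star (P v) = star (κ v w) • star (P (v + w)) := by
      rw [← star_mul, hP.mul, star_smul]
    calc Q v * (Q w * M * star (P w)) * star (P v)
        = (Q v * Q w) * M * (star (P w) * star (P v)) := by simp only [mul_assoc]
      _ = (κ v w * star (κ v w)) • (Q (v + w) * M * star (P (v + w))) := by
          rw [hmul, h1, smul_mul_assoc, smul_mul_smul_comm]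
      _ = _ := by rw [hP.star_cocycle_mul, one_smul]; rfl
  obtain ⟨M, hM⟩ : ∃ M, T M ≠ 0 := by
    by_contra! h
    have hli := Fintype.linearIndependent_iff.mp hP.linearIndependent
    have hz : Q 0 = 0 := by
      ext k i
      have hk := hli (fun w => star (Q w k i)) (by
        ext l j
        have h1 := congrFun (congrFun (h (Matrix.single i j 1)) k) l
        simp only [T, Matrix.sum_apply, Matrix.zero_apply] at h1 ⊢
        have h2 := congrArg star h1
        rw [star_sum, star_zero] at h2
        rw [← h2]
        refine Finset.sum_congr rfl fun w _ => ?_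
        rw [Matrix.mul_apply, Finset.sum_eq_single j]
        · simp [mul_comm]
        · intro b _ hb
          simp [Matrix.mul_apply, hb.symm]
        · simp) 0
      exact star_eq_zero.mp hk
    have := hP.nonempty
    have h1 := (hQ 0).1
    rw [hz, mul_zero] at h1
    exact zero_ne_one h1
  set U := T M with hU
  have hTU : ∀ v, Q v * U * star (P v) = U := hT M
  have hUQ : ∀ v, U * P v = Q v * U := fun v => by
    conv_lhs => rw [← hTU v]
    rw [mul_assoc, hP.star_mul_self, mul_one]
  have hPU : ∀ v, P v * star U = star U * Q v := fun v => by
    have h1 : star (Q v) * U = U * star (P v) := by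
      conv_lhs => rw [← hTU v]
      rw [← mul_assoc, ← mul_assoc, (hQ v).1, one_mul]
    have h2 := congrArg star h1
    rw [star_mul, star_mul, star_star, star_star] at h2
    exact h2.symm
  have hcomm : ∀ v, P v * (star U * U) = (star U * U) * P v := fun v => by
    rw [← mul_assoc, hPU, mul_assoc, ← hUQ, mul_assoc]
  have hs := hP.eq_smul_one_of_commute hcomm
  -- The scalar is a positive real number, so `U` can be normalised to a unitary matrix.
  obtain ⟨r, hr, hrs⟩ : ∃ r : ℝ, 0 < r ∧ star U * U = (r : ℂ) • 1 := by
    obtain ⟨i⟩ := hP.nonempty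
    obtain ⟨k, l, hkl⟩ : ∃ k l, U k l ≠ 0 := by
      by_contra! h
      exact hM (Matrix.ext h)
    have hdiag : ∀ j, (star U * U) j j = ((∑ k, Complex.normSq (U k j) : ℝ) : ℂ) := fun j => by
      rw [Matrix.mul_apply, Complex.ofReal_sum]
      refine Finset.sum_congr rfl fun k _ => ?_
      rw [Matrix.star_apply, Complex.normSq_eq_conj_mul_self]
      rfl
    refine ⟨∑ k, Complex.normSq (U k l), ?_, ?_⟩
    · exact Finset.sum_pos' (fun _ _ => Complex.normSq_nonneg _)
        ⟨k, Finset.mem_univ _, Complex.normSq_pos.mpr hkl⟩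
    · rw [← hdiag]
      conv_rhs => rw [hs]
      conv_lhs => rw [hs]
      simp
  have hc : ((Real.sqrt r : ℝ) : ℂ) ≠ 0 := by
    exact_mod_cast (Real.sqrt_pos.mpr hr).ne'
  have hsq : ((Real.sqrt r : ℝ) : ℂ) * (Real.sqrt r : ℝ) = r := by
    exact_mod_cast Real.mul_self_sqrt hr.le
  set s : ℂ := ((Real.sqrt r : ℝ) : ℂ)
  have hstar : star s = s := Complex.conj_ofReal _
  have hmem : s⁻¹ • U ∈ unitaryGroup ι ℂ := by
    rw [mem_unitaryGroup_iff', star_smul, smul_mul_smul_comm, hrs, smul_smul, star_inv₀, hstar,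
      ← mul_inv, hsq, inv_mul_cancel₀, one_smul]
    exact_mod_cast hr.ne'
  refine ⟨s⁻¹ • U, hmem, fun v => ?_⟩
  rw [smul_mul_assoc, hUQ, ← mul_smul_comm, mul_assoc, hmem.2, mul_one]

end IsWeylSystem

end

/-! ### The group of unitary lifts -/

section

open Matrix

/-- The trace of an endomorphism of a matrix algebra that fixes the identity is one more than its
trace on the traceless matrices. -/
theorem Matrix.trace_restrict_ker_trace {ι : Type*} [Fintype ι] [DecidableEq ι] [Nonempty ι]
    (F : Matrix ι ι ℂ →ₗ[ℂ] Matrix ι ι ℂ) (h1 : F 1 = 1)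
    (hF : ∀ A ∈ LinearMap.ker (traceLinearMap ι ℂ ℂ), F A ∈ LinearMap.ker (traceLinearMap ι ℂ ℂ)) :
    LinearMap.trace ℂ _ F = 1 + LinearMap.trace ℂ _ (F.restrict hF) := by
  have hd : (Fintype.card ι : ℂ) ≠ 0 := Nat.cast_ne_zero.mpr Fintype.card_ne_zero
  let W := LinearMap.ker (traceLinearMap ι ℂ ℂ)
  let τ : Matrix ι ι ℂ →ₗ[ℂ] Matrix ι ι ℂ :=
    (Fintype.card ι : ℂ)⁻¹ • (traceLinearMap ι ℂ ℂ).smulRight 1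
  have hτ : ∀ A, τ A = ((Fintype.card ι : ℂ)⁻¹ * A.trace) • 1 := fun A => by
    simp [τ, smul_smul]
  let π : Matrix ι ι ℂ →ₗ[ℂ] W := (LinearMap.id - τ).codRestrict W fun A => by
    simp only [W, LinearMap.mem_ker, LinearMap.sub_apply, LinearMap.id_apply, hτ,
      traceLinearMap_apply, trace_sub, trace_smul, trace_one, smul_eq_mul]
    field_simp
    ring
  have hsplit : F = (F ∘ₗ W.subtype) ∘ₗ π + (Fintype.card ι : ℂ)⁻¹ •
      (traceLinearMap ι ℂ ℂ).smulRight 1 := by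
    refine LinearMap.ext fun A => ?_
    simp [π, hτ, h1, smul_smul]
  have hrestr : π ∘ₗ F ∘ₗ W.subtype = F.restrict hF := by
    refine LinearMap.ext fun A => Subtype.ext ?_
    have hA : (F A).trace = 0 := hF A A.2
    simp [π, hτ, hA, W]
  conv_lhs => rw [hsplit]
  rw [map_add, LinearMap.trace_comp_comm', hrestr, map_smul, LinearMap.trace_smulRight]
  simp [hd, add_comm, W]

/-- A unitary matrix can be rescaled to have determinant one. -/
theorem Matrix.exists_smul_mem_specialUnitaryGroup {ι : Type*} [Fintype ι] [DecidableEq ι]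
    [Nonempty ι] {U : Matrix ι ι ℂ} (hU : U ∈ unitaryGroup ι ℂ) :
    ∃ a : ℂ, a ≠ 0 ∧ a • U ∈ specialUnitaryGroup ι ℂ := by
  have hn := Matrix.det_of_mem_unitary hU
  have hnorm : ‖U.det‖ = 1 := CStarRing.norm_of_mem_unitary hn
  have hne : U.det ≠ 0 := fun h => by simp [h] at hnorm
  obtain ⟨a, ha⟩ := IsAlgClosed.exists_pow_nat_eq (U.det)⁻¹ (Fintype.card_pos (α := ι))
  have hanorm : ‖a‖ = 1 := by
    have := congrArg norm ha
    rw [norm_pow, norm_inv, hnorm, inv_one] at this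
    exact (pow_eq_one_iff_of_nonneg (norm_nonneg a) Fintype.card_ne_zero).mp this
  refine ⟨a, fun h => by simp [h] at hanorm, ?_, ?_⟩
  · change a • U ∈ unitaryGroup ι ℂ
    rw [mem_unitaryGroup_iff', star_smul, smul_mul_smul_comm, (mem_unitaryGroup_iff'.mp hU)]
    have : star a * a = 1 := by
      rw [Complex.star_def, Complex.conj_mul', hanorm]
      norm_num
    rw [this, one_smul]
  · change (a • U).det = 1
    rw [det_smul, ha, inv_mul_cancel₀ hne]

namespace IsWeylSystem

variable {V ι H : Type*} [AddCommGroup V] [Fintype V] [Fintype ι] [DecidableEq ι] [Group H]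
  {κ : V → V → ℂ} {P : V → Matrix ι ι ℂ} (hP : IsWeylSystem κ P) (f : H →* Equiv.Perm V)

/-- The group of all pairs `(U, h)` with `U ∈ SU(ι)`, `h ∈ H`, such that conjugation by `U`
permutes the Weyl system up to scalars in the way `h` permutes its index set `V`. -/
def liftGroup : Subgroup (specialUnitaryGroup ι ℂ × H) where
  carrier := {g | ∀ v, ∃ c : ℂ, g.1.1 * P v * star g.1.1 = c • P (f g.2 v)}
  one_mem' v := ⟨1, by simp⟩
  mul_mem' {g g'} hg hg' v := by
    obtain ⟨c', hc'⟩ := hg' v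
    obtain ⟨c, hc⟩ := hg (f g'.2 v)
    refine ⟨c' * c, ?_⟩
    change (g.1.1 * g'.1.1) * P v * star (g.1.1 * g'.1.1) = (c' * c) • P (f (g.2 * g'.2) v)
    calc (g.1.1 * g'.1.1) * P v * star (g.1.1 * g'.1.1)
        = g.1.1 * (g'.1.1 * P v * star g'.1.1) * star g.1.1 := by
          rw [star_mul]; simp only [mul_assoc]
      _ = _ := by
          rw [hc', mul_smul_comm, smul_mul_assoc, hc, smul_smul, map_mul]; rfl
  inv_mem' {g} hg v := by
    obtain ⟨c, hc⟩ := hg ((f g.2)⁻¹ v)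
    have hU : star g.1.1 * g.1.1 = 1 := g.1.2.1.1
    rw [show f g.2 ((f g.2)⁻¹ v) = v from (f g.2).apply_symm_apply v] at hc
    have h2 : P ((f g.2)⁻¹ v) = c • (star g.1.1 * P v * g.1.1) := by
      calc P ((f g.2)⁻¹ v) = (star g.1.1 * g.1.1) * P ((f g.2)⁻¹ v) * (star g.1.1 * g.1.1) := by
            rw [hU, one_mul, mul_one]
        _ = star g.1.1 * (g.1.1 * P ((f g.2)⁻¹ v) * star g.1.1) * g.1.1 := by
            simp only [mul_assoc]
        _ = _ := by rw [hc, mul_smul_comm, smul_mul_assoc]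
    have hc0 : c ≠ 0 := fun h => hP.ne_zero _ (by rw [h2, h, zero_smul])
    refine ⟨c⁻¹, ?_⟩
    change star g.1.1 * P v * star (star g.1.1) = c⁻¹ • P (f g.2⁻¹ v)
    rw [star_star, map_inv, h2, smul_smul, inv_mul_cancel₀ hc0, one_smul]

/-- The projection of the group of pairs `(U, h)` to `H`. -/
def proj : hP.liftGroup f →* H := (MonoidHom.snd _ _).comp (hP.liftGroup f).subtype

/-- The matrix `U` of a pair `(U, h)`. -/
def mat : hP.liftGroup f →* Matrix ι ι ℂ :=
  (Submonoid.subtype _).comp ((MonoidHom.fst _ _).comp (hP.liftGroup f).subtype)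

/-- Every element of `H` permutes the Weyl system `P`, up to scalars, by a unitary conjugation. -/
def HasUnitaryLifts (P : V → Matrix ι ι ℂ) (f : H →* Equiv.Perm V) : Prop :=
  ∀ h, ∃ U ∈ unitaryGroup ι ℂ, ∀ v, ∃ c : ℂ, U * P v * star U = c • P (f h v)

variable {f}

theorem liftGroup_ext {g g' : hP.liftGroup f} (h1 : hP.mat f g = hP.mat f g')
    (h2 : hP.proj f g = hP.proj f g') : g = g' :=
  Subtype.ext (Prod.ext (Subtype.ext h1) h2)

theorem mat_mem_unitaryGroup (g : hP.liftGroup f) : hP.mat f g ∈ unitaryGroup ι ℂ := g.1.1.2.1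

theorem star_mat_mul_mat (g : hP.liftGroup f) : star (hP.mat f g) * hP.mat f g = 1 :=
  (hP.mat_mem_unitaryGroup g).1

theorem mat_mul_star_mat (g : hP.liftGroup f) : hP.mat f g * star (hP.mat f g) = 1 :=
  (hP.mat_mem_unitaryGroup g).2

theorem mat_inv (g : hP.liftGroup f) : hP.mat f g⁻¹ = star (hP.mat f g) := rfl

theorem det_mat (g : hP.liftGroup f) : (hP.mat f g).det = 1 := g.1.1.2.2

theorem mat_conj (g : hP.liftGroup f) (v : V) :
    ∃ c : ℂ, c ≠ 0 ∧ hP.mat f g * P v * star (hP.mat f g) = c • P (f (hP.proj f g) v) := by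
  obtain ⟨c, hc⟩ := g.2 v
  refine ⟨c, fun h0 => hP.ne_zero v ?_, hc⟩
  change hP.mat f g * P v * star (hP.mat f g) = c • _ at hc
  rw [h0, zero_smul] at hc
  calc P v = (star (hP.mat f g) * hP.mat f g) * P v * (star (hP.mat f g) * hP.mat f g) := by
        rw [hP.star_mat_mul_mat, one_mul, mul_one]
    _ = star (hP.mat f g) * (hP.mat f g * P v * star (hP.mat f g)) * hP.mat f g := by
        simp only [mul_assoc]
    _ = 0 := by rw [hc, mul_zero, zero_mul]

theorem exists_mem_liftGroup {U : Matrix ι ι ℂ} (hU : U ∈ unitaryGroup ι ℂ) {h : H}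
    (hlift : ∀ v, ∃ c : ℂ, U * P v * star U = c • P (f h v)) :
    ∃ (g : hP.liftGroup f) (a : ℂ), a ≠ 0 ∧ hP.mat f g = a • U ∧ hP.proj f g = h := by
  have := hP.nonempty
  obtain ⟨a, ha, haU⟩ := exists_smul_mem_specialUnitaryGroup hU
  refine ⟨⟨(⟨a • U, haU⟩, h), fun v => ?_⟩, a, ha, rfl, rfl⟩
  obtain ⟨c, hc⟩ := hlift v
  refine ⟨a * star a * c, ?_⟩
  change (a • U) * P v * star (a • U) = _
  rw [star_smul, smul_mul_assoc, smul_mul_smul_comm, hc, smul_smul]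

theorem proj_surjective (hf : HasUnitaryLifts P f) : Function.Surjective (hP.proj f) := fun h => by
  obtain ⟨U, hU, hlift⟩ := hf h
  obtain ⟨g, -, -, -, hg⟩ := hP.exists_mem_liftGroup hU hlift
  exact ⟨g, hg⟩

variable (f) in
/-- The Weyl operators, rescaled to determinant one, lie in the group. -/
theorem exists_mat_eq_smul (u : V) :
    ∃ (g : hP.liftGroup f) (a : ℂ), a ≠ 0 ∧ hP.mat f g = a • P u ∧ hP.proj f g = 1 :=
  hP.exists_mem_liftGroup (hP.mem_unitary u) fun v => by
    rw [map_one]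
    exact hP.exists_conj_eq u v

/-- The kernel of the projection consists of scalar multiples of Weyl operators. -/
theorem mat_eq_smul_of_proj_eq_one {g : hP.liftGroup f} (hg : hP.proj f g = 1) :
    ∃ (u : V) (a : ℂ), a ≠ 0 ∧ hP.mat f g = a • P u := by
  have hne : hP.mat f g ≠ 0 := fun h => by
    have := hP.nonempty
    have h1 := hP.star_mat_mul_mat g
    rw [h, mul_zero] at h1
    exact zero_ne_one h1
  obtain ⟨u, a, h⟩ := hP.exists_eq_smul_of_conj hne fun v => by
    obtain ⟨c, hc0, hc⟩ := hP.mat_conj g v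
    rw [hg, map_one, Equiv.Perm.one_apply] at hc
    refine ⟨c⁻¹, ?_⟩
    have h1 : hP.mat f g * P v = c • (P v * hP.mat f g) := by
      rw [← smul_mul_assoc, ← hc, mul_assoc, hP.star_mat_mul_mat, mul_one]
    have h2 : P v * hP.mat f g = c⁻¹ • (hP.mat f g * P v) := by
      rw [h1, smul_smul, inv_mul_cancel₀ hc0, one_smul]
    rw [h2, smul_mul_assoc, mul_assoc, hP.mul_star_self, mul_one]
  exact ⟨u, a, fun h0 => hne (by rw [h, h0, zero_smul]), h⟩

/-- The center consists of the pairs `(U, 1)` with `U` scalar: an element commuting with all Weyl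
operators is scalar, and then fixes their index set. -/
theorem mem_center_iff (hinj : Function.Injective f) (g : hP.liftGroup f) :
    g ∈ Subgroup.center (hP.liftGroup f) ↔ hP.proj f g = 1 ∧ ∃ a : ℂ, hP.mat f g = a • 1 := by
  constructor
  · intro hg
    have hcomm : ∀ v, P v * hP.mat f g = hP.mat f g * P v := fun v => by
      obtain ⟨e, a, ha, he, -⟩ := hP.exists_mat_eq_smul f v
      have h := congrArg (hP.mat f) (Subgroup.mem_center_iff.mp hg e)
      rw [map_mul, map_mul, he, smul_mul_assoc, mul_smul_comm] at h
      exact smul_right_injective _ ha h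
    refine ⟨hinj (Equiv.ext fun v => ?_), _, hP.eq_smul_one_of_commute hcomm⟩
    obtain ⟨c, -, hc⟩ := hP.mat_conj g v
    rw [← hcomm, mul_assoc, hP.mat_mul_star_mat, mul_one] at hc
    rw [map_one, Equiv.Perm.one_apply]
    exact (hP.eq_of_smul_eq one_ne_zero (by rw [one_smul]; exact hc)).symm
  · rintro ⟨h1, a, ha⟩
    rw [Subgroup.mem_center_iff]
    intro e
    apply hP.liftGroup_ext
    · rw [map_mul, map_mul, ha, mul_smul_comm, smul_mul_assoc, one_mul, mul_one]
    · rw [map_mul, map_mul, h1, one_mul, mul_one]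

theorem center_le_ker (hinj : Function.Injective f) :
    Subgroup.center (hP.liftGroup f) ≤ (hP.proj f).ker :=
  fun g hg => ((hP.mem_center_iff hinj g).mp hg).1

/-- The Weyl operators, one for each element of `V`, represent the cosets of the center in the
kernel of the projection. -/
theorem relIndex_center_ker (hinj : Function.Injective f) :
    (Subgroup.center (hP.liftGroup f)).relIndex (hP.proj f).ker = Fintype.card ι ^ 2 := by
  choose e a ha he he1 using hP.exists_mat_eq_smul f
  let E := (hP.proj f).ker
  let Z := Subgroup.center (hP.liftGroup f)
  let e' : V → E := fun v => ⟨e v, he1 v⟩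
  have key : ∀ (v : V) (g : E) (u : V) (b : ℂ), b ≠ 0 → hP.mat f g = b • P u →
      ((QuotientGroup.mk (e' v) : E ⧸ Z.subgroupOf E) = QuotientGroup.mk g ↔ v = u) := by
    intro v g u b hb hg
    rw [QuotientGroup.eq, Subgroup.mem_subgroupOf]
    change (e v)⁻¹ * g.1 ∈ Subgroup.center (hP.liftGroup f) ↔ _
    have hm : hP.mat f ((e v)⁻¹ * g.1) = (star (a v) * b) • (star (P v) * P u) := by
      rw [map_mul, hP.mat_inv, he, hg, star_smul, smul_mul_smul_comm]
    rw [hP.mem_center_iff hinj, hm]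
    constructor
    · rintro ⟨-, c, hc⟩
      have h2 : (star (a v) * b) • P u = c • P v := by
        have := congrArg (fun X => P v * X) hc
        simpa only [mul_smul_comm, ← mul_assoc, hP.mul_star_self, one_mul, mul_one] using this
      exact (hP.eq_of_smul_eq (mul_ne_zero (star_ne_zero.mpr (ha v)) hb) h2).symm
    · rintro rfl
      refine ⟨by rw [map_mul, map_inv, he1, g.2, inv_one, one_mul], star (a v) * b, ?_⟩
      rw [hP.star_mul_self]
  have hbij : Function.Bijective fun v => (QuotientGroup.mk (e' v) : E ⧸ Z.subgroupOf E) := by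
    constructor
    · intro v w hvw
      exact (key v (e' w) w (a w) (ha w) (he w)).mp hvw
    · intro q
      obtain ⟨g, rfl⟩ := QuotientGroup.mk_surjective q
      obtain ⟨u, b, hb, hg⟩ := hP.mat_eq_smul_of_proj_eq_one g.2
      exact ⟨u, (key u g u b hb hg).mpr rfl⟩
  rw [Subgroup.relIndex, Subgroup.index, ← Nat.card_eq_of_bijective _ hbij,
    Nat.card_eq_fintype_card, hP.card_eq]

theorem finite_liftGroup [Finite H] : Finite (hP.liftGroup f) := by
  -- A pair `(U, h)` is determined by `h`, by `U₀⁻¹ U` up to scalars for a chosen lift `U₀` of `h`,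
  -- and by a scalar that is a root of unity because of the determinants.
  choose e a ha he he1 using hP.exists_mat_eq_smul f
  have hfin : Finite (hP.proj f).ker := by
    let n := Fintype.card ι
    have : NeZero n := ⟨hP.card_pos.ne'⟩
    have : ∀ g : (hP.proj f).ker, ∃ p : V × rootsOfUnity n ℂ,
        hP.mat f g = ((p.2 : ℂˣ) : ℂ) • hP.mat f (e p.1) := by
      intro g
      obtain ⟨u, b, hb, hg⟩ := hP.mat_eq_smul_of_proj_eq_one g.2
      have h1 : hP.mat f g = (b / a u) • hP.mat f (e u) := by
        rw [he, smul_smul, div_mul_cancel₀ _ (ha u), hg]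
      have h2 : (b / a u) ^ n = 1 := by
        have := congrArg det h1
        rwa [det_smul, hP.det_mat, hP.det_mat, mul_one, eq_comm] at this
      exact ⟨(u, rootsOfUnity.mkOfPowEq _ h2), by simpa using h1⟩
    choose p hp using this
    refine Finite.of_injective p fun g g' h => Subtype.ext (hP.liftGroup_ext ?_ ?_)
    · rw [hp, hp, h]
    · rw [g.2, g'.2]
  have : Finite (hP.liftGroup f ⧸ (hP.proj f).ker) :=
    Finite.of_injective _ (QuotientGroup.kerLift_injective (hP.proj f))
  exact Finite.of_equiv _ (Subgroup.groupEquivQuotientProdSubgroup (s := (hP.proj f).ker)).symm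

theorem isSolvable_liftGroup (hinj : Function.Injective f) [hH : Group.IsSolvable H] :
    Group.IsSolvable (hP.liftGroup f) := by
  have hker : Group.IsSolvable (hP.proj f).ker := by
    -- Commutators of rescaled Weyl operators are scalar.
    let E := (hP.proj f).ker
    let Z := (Subgroup.center (hP.liftGroup f)).subgroupOf E
    have hZ : Group.IsSolvable Z := Group.isSolvable_of_comm fun x y => by
      apply Subtype.ext
      apply Subtype.ext
      exact (Subgroup.mem_center_iff.mp (Subgroup.mem_subgroupOf.mp x.2) y.1.1).symm
    have hQ : Group.IsSolvable (E ⧸ Z) := Group.isSolvable_of_comm fun x y => by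
      obtain ⟨x, rfl⟩ := QuotientGroup.mk_surjective x
      obtain ⟨y, rfl⟩ := QuotientGroup.mk_surjective y
      rw [← QuotientGroup.mk_mul, ← QuotientGroup.mk_mul, QuotientGroup.eq,
        Subgroup.mem_subgroupOf]
      change (x.1 * y.1)⁻¹ * (y.1 * x.1) ∈ Subgroup.center (hP.liftGroup f)
      obtain ⟨u, b, hb, hx⟩ := hP.mat_eq_smul_of_proj_eq_one x.2
      obtain ⟨v, c, hc, hy⟩ := hP.mat_eq_smul_of_proj_eq_one y.2
      refine (hP.mem_center_iff hinj _).mpr ⟨?_, star (b * c * κ u v) * (c * b * κ v u), ?_⟩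
      · rw [map_mul, map_inv, map_mul, map_mul, x.2, y.2]
        simp
      · rw [map_mul, hP.mat_inv, map_mul, map_mul, hx, hy, smul_mul_smul_comm, smul_mul_smul_comm,
          hP.mul, hP.mul, smul_smul, smul_smul, star_smul, smul_mul_smul_comm, add_comm v u,
          hP.star_mul_self]
    exact Group.isSolvable_of_ker_le_range Z.subtype (QuotientGroup.mk' Z) (by simp)
  exact Group.isSolvable_of_ker_le_range (hP.proj f).ker.subtype (hP.proj f) (by simp)

/-- If `H` is transitive on the nonzero elements of `V`, there is no normal subgroup strictly
between the scalars and the Weyl operators. -/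
theorem isChiefFactor_center_ker (hinj : Function.Injective f) (hf : HasUnitaryLifts P f)
    (htrans : ∀ u v : V, u ≠ 0 → v ≠ 0 → ∃ h, f h u = v) (hι : 1 < Fintype.card ι) :
    IsChiefFactor (Subgroup.center (hP.liftGroup f)) (hP.proj f).ker where
  normal_bot := inferInstance
  normal_top := inferInstance
  lt := by
    refine lt_of_le_of_ne (hP.center_le_ker hinj) fun h => ?_
    have h1 := hP.relIndex_center_ker hinj
    rw [h, Subgroup.relIndex_self] at h1
    nlinarith
  eq_or_eq N hN hZN hNE := by
    by_cases hNZ : N ≤ Subgroup.center (hP.liftGroup f)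
    · exact Or.inl (le_antisymm hNZ hZN)
    refine Or.inr (le_antisymm hNE fun x hx => ?_)
    obtain ⟨g, hg, hgZ⟩ := SetLike.not_le_iff_exists.mp hNZ
    obtain ⟨u, b, hb, hgu⟩ := hP.mat_eq_smul_of_proj_eq_one (hNE hg)
    have hu : u ≠ 0 := by
      rintro rfl
      exact hgZ ((hP.mem_center_iff hinj g).mpr ⟨hNE hg, b, by rw [hgu, hP.zero]⟩)
    obtain ⟨v, c, hc, hxv⟩ := hP.mat_eq_smul_of_proj_eq_one hx
    by_cases hv : v = 0
    · exact hZN ((hP.mem_center_iff hinj x).mpr ⟨hx, c, by rw [hxv, hv, hP.zero]⟩)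
    obtain ⟨h, hh⟩ := htrans u v hu hv
    obtain ⟨k, hk⟩ := hP.proj_surjective hf h
    have hconj : k * g * k⁻¹ ∈ N := hN.conj_mem g hg k
    obtain ⟨s, hs0, hs⟩ := hP.mat_conj k u
    have hm : hP.mat f (k * g * k⁻¹) = (b * s) • P v := by
      rw [map_mul, map_mul, hP.mat_inv, hgu, mul_smul_comm, smul_mul_assoc, hs, smul_smul, hk, hh]
    -- `x` differs from this conjugate of `g` by a scalar.
    have hz : x * (k * g * k⁻¹)⁻¹ ∈ Subgroup.center (hP.liftGroup f) := by
      refine (hP.mem_center_iff hinj _).mpr ⟨?_, c * star (b * s), ?_⟩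
      · rw [map_mul, map_inv, show hP.proj f x = 1 from hx,
          show hP.proj f (k * g * k⁻¹) = 1 from hNE hconj, inv_one, one_mul]
      · rw [map_mul, hP.mat_inv, hm, hxv, star_smul, smul_mul_smul_comm, hP.mul_star_self]
    have := N.mul_mem (hZN hz) hconj
    rwa [inv_mul_cancel_right] at this

end IsWeylSystem

end

/-! ### Its representations on vectors and on traceless matrices -/

section

open Matrix

namespace IsWeylSystem

variable {V ι H : Type*} [AddCommGroup V] [Fintype V] [Fintype ι] [DecidableEq ι] [Group H]
  {κ : V → V → ℂ} {P : V → Matrix ι ι ℂ} (hP : IsWeylSystem κ P) (f : H →* Equiv.Perm V)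

/-- The defining representation of the group of pairs `(U, h)`. -/
def stdRep : Representation ℂ (hP.liftGroup f) (ι → ℂ) :=
  (Matrix.toLinAlgEquiv' : Matrix ι ι ℂ ≃ₐ[ℂ] _).toAlgHom.toMonoidHom.comp (hP.mat f)

theorem stdRep_apply (g : hP.liftGroup f) (w : ι → ℂ) : hP.stdRep f g w = hP.mat f g *ᵥ w := rfl

theorem character_stdRep (g : hP.liftGroup f) :
    (hP.stdRep f).character g = (hP.mat f g).trace :=
  Matrix.trace_toLin'_eq _

/-- The conjugation representation of the group of pairs `(U, h)` on all matrices. -/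
def conjRep : Representation ℂ (hP.liftGroup f) (Matrix ι ι ℂ) where
  toFun g := LinearMap.mulLeft ℂ (hP.mat f g) ∘ₗ LinearMap.mulRight ℂ (star (hP.mat f g))
  map_one' := LinearMap.ext fun A => by simp
  map_mul' g g' := LinearMap.ext fun A => by simp [mul_assoc]

theorem conjRep_apply (g : hP.liftGroup f) (A : Matrix ι ι ℂ) :
    hP.conjRep f g A = hP.mat f g * A * star (hP.mat f g) := by
  simp [conjRep, mul_assoc]

theorem trace_conjRep_apply (g : hP.liftGroup f) (A : Matrix ι ι ℂ) :
    (hP.conjRep f g A).trace = A.trace := by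
  rw [conjRep_apply, trace_mul_comm, ← mul_assoc, hP.star_mat_mul_mat, one_mul]

/-- The conjugation representation on the traceless matrices. -/
def tracelessRep : Subrepresentation (hP.conjRep f) where
  toSubmodule := LinearMap.ker (traceLinearMap ι ℂ ℂ)
  apply_mem_toSubmodule g A hA := (hP.trace_conjRep_apply f g A).trans hA

variable {f}

theorem isIrreducible_stdRep : (hP.stdRep f).IsIrreducible := by
  have := hP.nonempty
  refine Representation.isIrreducible_of_forall_eq_top _ fun S hS hbot => ?_
  obtain ⟨w, hw, hw0⟩ := S.exists_mem_ne_zero_of_ne_bot hbot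
  -- `S` is stable under the Weyl operators, hence under all matrices.
  have hall : ∀ A : Matrix ι ι ℂ, A *ᵥ w ∈ S := by
    refine hP.mem_of_forall_mem (S.comap ((Matrix.mulVecBilin ℂ ℂ).flip w)) fun v => ?_
    obtain ⟨g, a, ha, hg, -⟩ := hP.exists_mat_eq_smul f v
    have h := S.smul_mem a⁻¹ (hS g w hw)
    rwa [stdRep_apply, hg, smul_mulVec, smul_smul, inv_mul_cancel₀ ha, one_smul] at h
  obtain ⟨j, hj⟩ := Function.ne_iff.mp hw0
  refine Submodule.eq_top_iff'.mpr fun x => ?_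
  have hx : x = Matrix.of (fun i k => if k = j then x i * (w j)⁻¹ else 0) *ᵥ w := by
    ext i
    simp [Matrix.mulVec, dotProduct, mul_assoc, inv_mul_cancel₀ hj]
  rw [hx]
  exact hall _

/-- Transitivity of `H` on the nonzero elements of `V` makes the traceless matrices an irreducible
module: averaging over the Weyl operators extracts some `P u` from an invariant subspace, and `H`
carries it to every other one. -/
theorem isIrreducible_tracelessRep (hf : HasUnitaryLifts P f)
    (htrans : ∀ u v : V, u ≠ 0 → v ≠ 0 → ∃ h, f h u = v) (hι : 1 < Fintype.card ι) :
    (hP.tracelessRep f).toRepresentation.IsIrreducible := by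
  let W : Submodule ℂ (Matrix ι ι ℂ) := LinearMap.ker (traceLinearMap ι ℂ ℂ)
  have : Nontrivial V := by
    rw [← Fintype.one_lt_card_iff_nontrivial, hP.card_eq]
    nlinarith
  obtain ⟨v₀, hv₀⟩ := exists_ne (0 : V)
  have : Nontrivial W :=
    ⟨⟨⟨P v₀, hP.trace_eq_zero v₀ hv₀⟩, 0, fun h => hP.ne_zero v₀ (congrArg Subtype.val h)⟩⟩
  refine Representation.isIrreducible_of_forall_eq_top (W := W) _ fun S' hS' hbot => ?_
  let S : Submodule ℂ (Matrix ι ι ℂ) := S'.map W.subtype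
  have hS : ∀ g, ∀ A ∈ S, hP.mat f g * A * star (hP.mat f g) ∈ S := by
    rintro g _ ⟨A, hA, rfl⟩
    exact ⟨_, hS' g A hA, hP.conjRep_apply f g A⟩
  obtain ⟨A', hA', hA0⟩ := S'.exists_mem_ne_zero_of_ne_bot hbot
  set A : Matrix ι ι ℂ := A'.1 with hAdef
  have hAS : A ∈ S := ⟨A', hA', rfl⟩
  have hAtr : A.trace = 0 := A'.2
  have hAne : A ≠ 0 := fun h => hA0 (Subtype.ext h)
  obtain ⟨u, hu⟩ := hP.exists_trace_ne_zero hAne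
  have hu0 : u ≠ 0 := by
    rintro rfl
    rw [hP.zero, star_one, one_mul] at hu
    exact hu hAtr
  have hWeyl : ∀ v, ∀ B ∈ S, P v * B * star (P v) ∈ S := by
    intro v B hB
    obtain ⟨g, a, ha, hg, -⟩ := hP.exists_mat_eq_smul f v
    have h := S.smul_mem (a * star a)⁻¹ (hS g B hB)
    rwa [hg, star_smul, smul_mul_assoc, smul_mul_smul_comm, smul_smul, inv_mul_cancel₀, one_smul]
      at h
    exact mul_ne_zero ha (star_ne_zero.mpr ha)
  have hPu : P u ∈ S := by
    -- The twirl of `star (P u) * A` commutes with all `P v`, so it is a nonzero scalar.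
    let X := ∑ w, P w * (star (P u) * A) * star (P w)
    have hX : ∀ v, P v * X = X * P v := by
      intro v
      have h1 : P v * X * star (P v) = X := by
        simp only [X, Finset.mul_sum, Finset.sum_mul]
        refine Fintype.sum_equiv (Equiv.addLeft v) _ _ fun w => ?_
        have h2 : star (P w) * star (P v) = star (κ v w) • star (P (v + w)) := by
          rw [← star_mul, hP.mul, star_smul]
        calc P v * (P w * (star (P u) * A) * star (P w)) * star (P v)
            = (P v * P w) * (star (P u) * A) * (star (P w) * star (P v)) := by
              simp only [mul_assoc]
          _ = (κ v w * star (κ v w)) •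
                (P (v + w) * (star (P u) * A) * star (P (v + w))) := by
              rw [hP.mul, h2, smul_mul_assoc, smul_mul_smul_comm]
          _ = _ := by rw [hP.star_cocycle_mul, one_smul]; rfl
      conv_rhs => rw [← h1]
      rw [mul_assoc, hP.star_mul_self, mul_one]
    have hXtr : X.trace = Fintype.card V * (star (P u) * A).trace := by
      simp only [X, trace_sum]
      rw [Finset.sum_congr rfl fun w _ => show
        (P w * (star (P u) * A) * star (P w)).trace = (star (P u) * A).trace by
          rw [trace_mul_comm, ← mul_assoc, hP.star_mul_self, one_mul]]
      simp
    have hXs := hP.eq_smul_one_of_commute hX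
    have hc : X.trace / Fintype.card ι ≠ 0 := by
      rw [hXtr]
      exact div_ne_zero (mul_ne_zero (Nat.cast_ne_zero.mpr Fintype.card_ne_zero) hu)
        hP.card_ne_zero
    set c := X.trace / Fintype.card ι
    have hmem : P u * X ∈ S := by
      rw [Finset.mul_sum]
      refine S.sum_mem fun w _ => ?_
      obtain ⟨b, hb⟩ := hP.exists_conj_eq w u
      have hb' : P w * star (P u) * star (P w) = star b • star (P u) := by
        have := congrArg star hb
        simpa [mul_assoc] using this
      have : P u * (P w * (star (P u) * A) * star (P w)) = star b • (P w * A * star (P w)) := by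
        calc P u * (P w * (star (P u) * A) * star (P w))
            = P u * ((P w * star (P u) * star (P w)) * (P w * A * star (P w))) := by
              simp only [mul_assoc]
              rw [← mul_assoc (star (P w)) (P w), hP.star_mul_self, one_mul]
          _ = _ := by
              rw [hb', smul_mul_assoc, mul_smul_comm, ← mul_assoc, hP.mul_star_self, one_mul]
      rw [this]
      exact S.smul_mem _ (hWeyl w A hAS)
    rw [hXs, mul_smul_comm, mul_one] at hmem
    have := S.smul_mem c⁻¹ hmem
    rwa [smul_smul, inv_mul_cancel₀ hc, one_smul] at this
  have hPall : ∀ v, v ≠ 0 → P v ∈ S := by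
    intro v hv
    obtain ⟨h, hh⟩ := htrans u v hu0 hv
    obtain ⟨g, hg⟩ := hP.proj_surjective hf h
    obtain ⟨c, hc0, hc⟩ := hP.mat_conj g u
    have := S.smul_mem c⁻¹ (hS g _ hPu)
    rwa [hc, smul_smul, inv_mul_cancel₀ hc0, one_smul, hg, hh] at this
  refine Submodule.eq_top_iff'.mpr fun B => ?_
  have hB : B.1 ∈ S := by
    rw [hP.eq_sum B.1]
    refine S.sum_mem fun v _ => ?_
    by_cases hv : v = 0
    · have hBtr : B.1.trace = 0 := B.2
      rw [hv, hP.zero, star_one, one_mul, hBtr, zero_div, zero_smul]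
      exact S.zero_mem
    · exact S.smul_mem _ (hPall v hv)
  obtain ⟨C, hC, hCB⟩ := hB
  rwa [← Subtype.ext (a1 := C) (a2 := B) hCB]

open scoped ComplexOrder in
theorem isFaithfulChar_trace_mat (hinj : Function.Injective f) :
    IsFaithfulChar fun g : hP.liftGroup f => (hP.mat f g).trace := by
  intro g hg
  simp only [map_one, trace_one] at hg
  -- For a unitary `U` with `tr U = tr 1`, the Frobenius norm of `U - 1` vanishes.
  have h1 : ((hP.mat f g - 1)ᴴ * (hP.mat f g - 1)).trace = 0 := by
    have h2 : (star (hP.mat f g)).trace = Fintype.card ι := by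
      rw [star_eq_conjTranspose, trace_conjTranspose, hg, star_natCast]
    rw [← star_eq_conjTranspose, star_sub, star_one, sub_mul, mul_sub, hP.star_mat_mul_mat, one_mul,
      mul_one, trace_sub, trace_sub, trace_sub, trace_one, hg, h2]
    ring
  have hU : hP.mat f g = 1 := sub_eq_zero.mp (trace_conjTranspose_mul_self_eq_zero_iff.mp h1)
  have hc : g ∈ Subgroup.center (hP.liftGroup f) := by
    rw [Subgroup.mem_center_iff]
    have hpr : hP.proj f g = 1 := hinj (Equiv.ext fun v => by
      obtain ⟨c, -, hc⟩ := hP.mat_conj g v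
      rw [hU, star_one, one_mul, mul_one] at hc
      rw [map_one, Equiv.Perm.one_apply]
      exact (hP.eq_of_smul_eq one_ne_zero (by rw [one_smul]; exact hc)).symm)
    intro e
    apply hP.liftGroup_ext <;> simp [hU, hpr]
  exact hP.liftGroup_ext (by rw [hU, map_one])
    (by rw [((hP.mem_center_iff hinj g).mp hc).1, map_one])

/-- `χ χ̄` is the character of the conjugation representation, which splits into the scalar and the
traceless matrices. -/
theorem trace_mul_conj_trace (g : hP.liftGroup f) :
    (hP.mat f g).trace * starRingEnd ℂ (hP.mat f g).trace =
      1 + (hP.tracelessRep f).toRepresentation.character g := by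
  have := hP.nonempty
  have h1 : hP.conjRep f g 1 = 1 := by rw [conjRep_apply, mul_one, hP.mat_mul_star_mat]
  have h2 := trace_restrict_ker_trace (hP.conjRep f g) h1
    (fun A hA => (hP.tracelessRep f).apply_mem_toSubmodule g hA)
  have h3 := trace_mulLeft_mulRight (hP.mat f g) (star (hP.mat f g))
  rw [star_eq_conjTranspose, trace_conjTranspose] at h3
  exact h3.symm.trans h2

end IsWeylSystem

/-- A Weyl system of degree `d`, together with a solvable group acting faithfully on its index set,
transitively on the nonzero elements, and by unitary conjugations, realizes degree `d`. -/
theorem isRealized_of_isWeylSystem {V ι H : Type} [AddCommGroup V] [Fintype V] [Fintype ι]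
    [DecidableEq ι] [Group H] [Finite H] [Group.IsSolvable H] {κ : V → V → ℂ}
    {P : V → Matrix ι ι ℂ} (hP : IsWeylSystem κ P) (f : H →* Equiv.Perm V)
    (hinj : Function.Injective f) (hf : IsWeylSystem.HasUnitaryLifts P f)
    (htrans : ∀ u v : V, u ≠ 0 → v ≠ 0 → ∃ h, f h u = v) {d : ℕ} (hd : Fintype.card ι = d)
    (hd1 : 1 < d) {C : (G : Type) → [Group G] → (E : Subgroup G) → [E.Normal] → Prop}
    (hC : C (hP.liftGroup f) (hP.proj f).ker) : IsRealized d C := by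
  refine ⟨hP.liftGroup f, inferInstance, hP.finite_liftGroup, fun g => (hP.mat f g).trace,
    (hP.tracelessRep f).toRepresentation.character, 1, (hP.proj f).ker, inferInstance, ?_, rfl,
    ?_, ?_, hC⟩
  · exact
      { solvable := hP.isSolvable_liftGroup hinj
        irr := by
          have h := IsIrrChar.of_isIrreducible _ (hP.isIrreducible_stdRep (f := f))
          rwa [funext (hP.character_stdRep f)] at h
        faithful := hP.isFaithfulChar_trace_mat hinj
        irr_constituent := IsIrrChar.of_isIrreducible _
          (hP.isIrreducible_tracelessRep hf htrans (hd ▸ hd1))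
        mult_pos := one_pos
        mul_conj := fun g => by rw [hP.trace_mul_conj_trace, Nat.cast_one, one_mul]
        chief := hP.isChiefFactor_center_ker hinj hf htrans (hd ▸ hd1) }
  · change (hP.mat f 1).trace ^ 2 = _
    rw [hP.relIndex_center_ker hinj, map_one, trace_one]
    push_cast
    rfl
  · change (hP.mat f 1).trace = _
    rw [map_one, trace_one, hd]

/-- The quotient of the group of pairs `(U, h)` by the Weyl operators is `H`. -/
noncomputable def IsWeylSystem.quotientKerEquiv {V ι H : Type*} [AddCommGroup V] [Fintype V]
    [Fintype ι] [DecidableEq ι] [Group H] {κ : V → V → ℂ} {P : V → Matrix ι ι ℂ}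
    (hP : IsWeylSystem κ P) {f : H →* Equiv.Perm V} (hf : HasUnitaryLifts P f) :
    hP.liftGroup f ⧸ (hP.proj f).ker ≃* H :=
  QuotientGroup.quotientKerEquivOfSurjective _ (hP.proj_surjective hf)

end

/-! ### Weyl operators over finite commutative rings -/

section

open Matrix

namespace IsWeylSystem

variable {V ι : Type*} [AddCommGroup V] [Fintype V] [Fintype ι] [DecidableEq ι]
  {κ : V → V → ℂ} {P : V → Matrix ι ι ℂ} (hP : IsWeylSystem κ P)

include hP in
theorem comp_addEquiv {W : Type*} [AddCommGroup W] [Fintype W] (e : W ≃+ V) :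
    IsWeylSystem (fun u v => κ (e u) (e v)) (fun v => P (e v)) where
  mem_unitary v := hP.mem_unitary _
  zero := by rw [map_zero, hP.zero]
  mul u v := by rw [hP.mul, map_add]
  star_cocycle_mul u v := hP.star_cocycle_mul _ _
  trace_eq_zero v hv := hP.trace_eq_zero _ (e.map_ne_zero_iff.mpr hv)
  card_eq := by rw [Fintype.card_congr e.toEquiv, hP.card_eq]

include hP in
/-- Automorphisms preserving the cocycle lift: composing the Weyl system with one gives a projective
representation with the same cocycle, which is unitarily equivalent to it. -/
theorem hasUnitaryLifts_of_cocycle_eq {H : Type*} [Group H] {f : H →* Equiv.Perm V}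
    (hadd : ∀ h u v, f h (u + v) = f h u + f h v)
    (hκ : ∀ h u v, κ (f h u) (f h v) = κ u v) : HasUnitaryLifts P f := by
  intro h
  obtain ⟨U, hU, hUP⟩ := hP.exists_unitary_conj (Q := fun v => P (f h v))
    (fun v => hP.mem_unitary _) (fun u v => by rw [hP.mul, hκ, hadd])
  exact ⟨U, hU, fun v => ⟨1, by rw [hUP, one_smul]⟩⟩

end IsWeylSystem

theorem AddChar.mul_conj_self {R : Type*} [CommRing R] [Finite R] (ψ : AddChar R ℂ) (x : R) :
    ψ x * starRingEnd ℂ (ψ x) = 1 := by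
  rw [← AddChar.map_neg_eq_conj, ← AddChar.map_add_eq_mul, add_neg_cancel,
    AddChar.map_zero_eq_one]

/-- The cocycle of the Weyl operators. -/
def weylCocycle {R : Type*} [CommRing R] (ψ : AddChar R ℂ) (τ : R) (u v : Fin 2 → R) : ℂ :=
  ψ (v 1 * u 0 - τ * (u 0 * v 1 + v 0 * u 1))

/-- If `2` is invertible, the Weyl operators are normalised so that the cocycle is the character
of half the determinant form. -/
theorem weylCocycle_eq {R : Type*} [CommRing R] (ψ : AddChar R ℂ) (τ : R) (hτ : 2 * τ = 1)
    (u v : Fin 2 → R) :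
    weylCocycle ψ τ u v = ψ (τ * (u 0 * v 1 - u 1 * v 0)) := by
  unfold weylCocycle
  congr 1
  linear_combination (-(v 1 * u 0)) * hτ

section WeylOperators

variable {R : Type*} [CommRing R] [Fintype R] [DecidableEq R] (ψ : AddChar R ℂ) (τ : R)

/-- The Weyl operator `f ↦ (x ↦ ψ (v₁ x + τ v₀ v₁) f (x + v₀))` on functions on the finite
commutative ring `R`, as a matrix. -/
def weylOp (v : Fin 2 → R) : Matrix R R ℂ :=
  fun x y => if y = x + v 0 then ψ (v 1 * x + τ * (v 0 * v 1)) else 0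

theorem isWeylSystem_weylOp (hψ : ψ.IsPrimitive) :
    IsWeylSystem (weylCocycle ψ τ) (weylOp ψ τ) where
  mem_unitary v := by
    rw [mem_unitaryGroup_iff]
    ext x z
    rw [Matrix.mul_apply, Finset.sum_eq_single (x + v 0)]
    · by_cases h : x = z
      · subst h
        simp [weylOp, AddChar.mul_conj_self]
      · simp [weylOp, h]
    · intro y _ hy
      simp [weylOp, hy]
    · simp
  zero := by
    ext x y
    simp [weylOp, Matrix.one_apply, eq_comm]
  mul u v := by
    ext x z
    rw [Matrix.mul_apply, Finset.sum_eq_single (x + u 0)]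
    · simp only [weylOp, weylCocycle, Matrix.smul_apply, Pi.add_apply, if_true, smul_eq_mul,
        mul_ite, mul_zero, add_assoc, ← AddChar.map_add_eq_mul]
      congr 2
      ring
    · intro y _ hy
      simp [weylOp, hy]
    · simp
  star_cocycle_mul u v := AddChar.mul_conj_self ψ _
  trace_eq_zero v hv := by
    simp only [Matrix.trace, Matrix.diag_apply, weylOp, left_eq_add]
    by_cases h0 : v 0 = 0
    · have h1 : v 1 ≠ 0 := fun h1 => hv (by ext i; fin_cases i <;> assumption)
      have := AddChar.sum_mulShift (v 1) hψ
      rw [if_neg h1] at this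
      simp only [h0, if_true, zero_mul, mul_zero, add_zero, mul_comm (v 1)]
      exact_mod_cast this
    · simp [h0]
  card_eq := by simp

end WeylOperators

/-- The permutation action of `SL₂(R)` on column vectors. -/
def slPerm (R : Type*) [CommRing R] : SpecialLinearGroup (Fin 2) R →* Equiv.Perm (Fin 2 → R) where
  toFun M := (SpecialLinearGroup.toLin' M).toEquiv
  map_one' := by ext; simp
  map_mul' M N := by ext; simp

theorem slPerm_apply {R : Type*} [CommRing R] (M : SpecialLinearGroup (Fin 2) R) (v : Fin 2 → R) :
    slPerm R M v = M.1 *ᵥ v := rfl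

theorem slPerm_injective (R : Type*) [CommRing R] : Function.Injective (slPerm R) := by
  intro M N h
  apply Subtype.ext
  apply Matrix.toLin'.injective
  exact LinearMap.ext fun v => congrArg (fun σ : Equiv.Perm (Fin 2 → R) => σ v) h

/-- Over a ring in which `2` is invertible, the Weyl operators lift all of `SL₂`: it preserves the
determinant form that governs the symmetrised cocycle. -/
theorem hasUnitaryLifts_slPerm {R H : Type*} [CommRing R] [Fintype R] [DecidableEq R] [Group H]
    (ψ : AddChar R ℂ) (hψ : ψ.IsPrimitive) {τ : R} (hτ : 2 * τ = 1)
    (φ : H →* SpecialLinearGroup (Fin 2) R) :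
    IsWeylSystem.HasUnitaryLifts (weylOp ψ τ) ((slPerm R).comp φ) := by
  refine (isWeylSystem_weylOp ψ τ hψ).hasUnitaryLifts_of_cocycle_eq
    (fun h u v => Matrix.mulVec_add (φ h).1 u v) fun h u v => ?_
  rw [weylCocycle_eq ψ τ hτ, weylCocycle_eq ψ τ hτ]
  congr 2
  have hdet := (φ h).2
  rw [Matrix.det_fin_two] at hdet
  simp only [MonoidHom.comp_apply, slPerm_apply, Matrix.mulVec, dotProduct, Fin.sum_univ_two]
  linear_combination (u 0 * v 1 - u 1 * v 0) * hdet

/-- A solvable subgroup of `SL₂(p)`, `p` odd, that is transitive on nonzero vectors realizes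
degree `p`. -/
theorem isRealized_of_transitive {p : ℕ} [NeZero p] (hp : 1 < p) {τ : ZMod p} (hτ : 2 * τ = 1)
    {H K : Type} [Group H] [Finite H] [Group.IsSolvable H] [Group K]
    (φ : H →* SpecialLinearGroup (Fin 2) (ZMod p)) (hφ : Function.Injective φ)
    (htrans : ∀ u v : Fin 2 → ZMod p, u ≠ 0 → v ≠ 0 → ∃ h, slPerm _ (φ h) u = v) (e : H ≃* K) :
    IsRealized p (fun G _ E _ => Nonempty (G ⧸ E ≃* K)) := by
  have hlift := hasUnitaryLifts_slPerm _ (ZMod.isPrimitive_stdAddChar p) hτ φ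
  exact isRealized_of_isWeylSystem
    (isWeylSystem_weylOp _ τ (ZMod.isPrimitive_stdAddChar p)) ((slPerm _).comp φ)
    ((slPerm_injective _).comp hφ) hlift htrans (ZMod.card p) hp
    ⟨(IsWeylSystem.quotientKerEquiv _ hlift).trans e⟩

end

/-! ### Transitive solvable groups in degrees three and five -/

section

open Matrix

/-- Transitivity on nonzero vectors can be checked from one base vector. -/
theorem transitive_of_base {V H : Type*} [Zero V] [Group H] (f : H →* Equiv.Perm V) (b : V)
    (hb : ∀ v : V, v ≠ 0 → ∃ h, f h b = v) (u v : V) (hu : u ≠ 0) (hv : v ≠ 0) :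
    ∃ h, f h u = v := by
  obtain ⟨h, rfl⟩ := hb u hu
  obtain ⟨k, rfl⟩ := hb v hv
  refine ⟨k * h⁻¹, ?_⟩
  rw [map_mul, map_inv, Equiv.Perm.mul_apply]
  exact congrArg (f k) ((f h).symm_apply_apply b)

/-- The power homomorphism `k ↦ g ^ k` from `ℤ/n` attached to an element with `g ^ n = 1`. -/
def zmodPowersHom {G : Type*} [Group G] {n : ℕ} [NeZero n] (g : G) (hg : g ^ n = 1) :
    Multiplicative (ZMod n) →* G :=
  MonoidHom.mk' (fun k => g ^ (Multiplicative.toAdd k).val) fun k l => by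
    rw [toAdd_mul, ZMod.val_add, ← pow_eq_pow_mod _ hg, pow_add]

/-- An extension of a solvable group by a `p`-group is solvable. -/
theorem isSolvable_of_isPGroup_ker {G G' : Type*} [Group G] [Finite G] [Group G']
    [Group.IsSolvable G'] (p : ℕ) [Fact p.Prime] (f : G →* G') (hf : IsPGroup p f.ker) :
    Group.IsSolvable G := by
  have := hf.isNilpotent
  exact Group.isSolvable_of_ker_le_range f.ker.subtype f (by simp)

/-- The homomorphism of `SL₂(3)` onto its abelianization, the cyclic group of order `3`. -/
def slThreeToCyclic : SpecialLinearGroup (Fin 2) (ZMod 3) →* Multiplicative (ZMod 3) :=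
  MonoidHom.mk' (fun M => Multiplicative.ofAdd
      ((1 - M.1 1 0 ^ 2) * M.1 0 1 * M.1 1 1 + M.1 1 0 * (M.1 0 0 + M.1 1 1)))
    (by decide +kernel)

instance : Group.IsSolvable (SpecialLinearGroup (Fin 2) (ZMod 3)) :=
  isSolvable_of_isPGroup_ker 2 slThreeToCyclic fun M => ⟨2, Subtype.ext (by
    have : ∀ M : SpecialLinearGroup (Fin 2) (ZMod 3), slThreeToCyclic M = 1 → M ^ 4 = 1 := by
      decide +kernel
    exact this M.1 M.2)⟩

/-- The sign homomorphism of `SL₂(2)`, a group isomorphic to the symmetric group `S₃`. -/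
def slTwoSign : SpecialLinearGroup (Fin 2) (ZMod 2) →* Multiplicative (ZMod 2) :=
  MonoidHom.mk' (fun M => Multiplicative.ofAdd
      (M.1 0 1 + M.1 1 0 + M.1 0 1 * M.1 1 0 * (1 + M.1 0 0 + M.1 1 1)))
    (by decide +kernel)

instance : Group.IsSolvable (SpecialLinearGroup (Fin 2) (ZMod 2)) :=
  isSolvable_of_isPGroup_ker 3 slTwoSign fun M => ⟨1, Subtype.ext (by
    have : ∀ M : SpecialLinearGroup (Fin 2) (ZMod 2), slTwoSign M = 1 → M ^ 3 = 1 := by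
      decide +kernel
    exact this M.1 M.2)⟩

instance : Group.IsSolvable (QuaternionGroup 2) := by
  have : IsPGroup 2 (QuaternionGroup 2) :=
    IsPGroup.of_card (n := 3) (by rw [Nat.card_eq_fintype_card, QuaternionGroup.card]; rfl)
  have := this.isNilpotent
  infer_instance

/-- The embedding of the quaternion group in `SL₂(3)`. -/
def quaternionToSL : QuaternionGroup 2 →* SpecialLinearGroup (Fin 2) (ZMod 3) :=
  MonoidHom.mk'
    (fun
      | .a i => ⟨!![0, 1; -1, 0] ^ i.val, by rw [det_pow]; simp⟩
      | .xa i => ⟨!![1, 1; 1, -1] * !![0, 1; -1, 0] ^ i.val, by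
          rw [det_mul, det_pow, det_fin_two_of, det_fin_two_of]
          simp
          decide⟩)
    (by decide +kernel)

theorem isRealized_three_quaternion :
    IsRealized 3 (fun G _ E _ => Nonempty (G ⧸ E ≃* QuaternionGroup 2)) :=
  isRealized_of_transitive (by norm_num) (τ := 2) (by decide) quaternionToSL
    (by unfold Function.Injective; decide +kernel)
    (transitive_of_base ((slPerm _).comp quaternionToSL) ![1, 0] (by
      change ∀ v : Fin 2 → ZMod 3, v ≠ 0 → ∃ h, slPerm _ (quaternionToSL h) ![1, 0] = v
      decide +kernel))
    (MulEquiv.refl _)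

theorem isRealized_three_sl :
    IsRealized 3 (fun G _ E _ =>
      Nonempty (G ⧸ E ≃* SpecialLinearGroup (Fin 2) (ZMod 3))) :=
  isRealized_of_transitive (by norm_num) (τ := 2) (by decide)
    (MonoidHom.id _) Function.injective_id
    (transitive_of_base (slPerm (ZMod 3)) ![1, 0] (by
      change ∀ v : Fin 2 → ZMod 3, v ≠ 0 → ∃ M : SpecialLinearGroup (Fin 2) (ZMod 3),
        slPerm _ M ![1, 0] = v
      decide +kernel))
    (MulEquiv.refl _)

/-- Hurwitz units modulo `3` to Hurwitz units modulo `5`. A matrix over `𝔽₃` is written as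
`t + x I + y J + z K` for a basis of quaternion units. The coordinates lift to a Hurwitz unit `± 1`,
`± i`, `± j`, `± k` if one of them vanishes, and to `- (± 1 ± i ± j ± k) / 2` otherwise (the signs
being the coordinates modulo `3`); the unit is then evaluated on quaternion units over `𝔽₅`, where
`- 1 / 2 = 2`. -/
def hurwitzThreeToFive (M : Matrix (Fin 2) (Fin 2) (ZMod 3)) : Matrix (Fin 2) (Fin 2) (ZMod 5) :=
  let l : ZMod 3 → ZMod 5 := fun c => if c = 0 then 0 else if c = 1 then 1 else -1
  let t := 2 * (M 0 0 + M 1 1)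
  let x := 2 * (M 0 1 - M 1 0)
  let y := M 0 0 - M 1 1 + M 0 1 + M 1 0
  let z := 2 * (M 0 1 + M 1 0 - M 0 0 + M 1 1)
  let s : ZMod 5 := if t * x * y * z = 0 then 1 else 2
  !![s * (l t + 2 * l y), s * (l x + 3 * l z); s * (3 * l z - l x), s * (l t + 3 * l y)]

/-- The embedding of `SL₂(3)` in `SL₂(5)`: both contain the image of the group of Hurwitz units. -/
def slThreeToSlFive :
    SpecialLinearGroup (Fin 2) (ZMod 3) →* SpecialLinearGroup (Fin 2) (ZMod 5) :=
  MonoidHom.mk'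
    (fun M => ⟨hurwitzThreeToFive M.1, by
      rw [det_fin_two]
      revert M
      decide +kernel⟩)
    (fun M N => Subtype.ext (by
      change hurwitzThreeToFive (M * N).1 = hurwitzThreeToFive M.1 * hurwitzThreeToFive N.1
      revert M N
      decide +kernel))

theorem isRealized_five_sl :
    IsRealized 5 (fun G _ E _ =>
      Nonempty (G ⧸ E ≃* SpecialLinearGroup (Fin 2) (ZMod 3))) :=
  isRealized_of_transitive (by norm_num) (τ := 3) (by decide) slThreeToSlFive
    ((injective_iff_map_eq_one _).mpr (by decide +kernel))
    (transitive_of_base ((slPerm _).comp slThreeToSlFive) ![1, 0] (by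
      change ∀ v : Fin 2 → ZMod 5, v ≠ 0 → ∃ h, slPerm _ (slThreeToSlFive h) ![1, 0] = v
      decide +kernel))
    (MulEquiv.refl _)

end

/-! ### The twisted form of `GL(2,3)` in degree seven -/

section

open Matrix

namespace TwistedGL23

/-- The generators `x`, `y`, `z` of the presented group, indexed by `0`, `1`, `2`. -/
def gen (i : Fin 3) : TwistedGL23 := PresentedGroup.of i

theorem mk_eq_one {r : FreeGroup (Fin 3)} (hr : r ∈ rels) : PresentedGroup.mk rels r = 1 :=
  PresentedGroup.one_of_mem hr

theorem x_pow_eight : gen 0 ^ 8 = 1 := mk_eq_one (Or.inl rfl)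

theorem y_sq : gen 1 ^ 2 = gen 0 ^ 4 := mul_inv_eq_one.mp (mk_eq_one (Or.inr (Or.inl rfl)))

theorem z_pow_three : gen 2 ^ 3 = 1 := mk_eq_one (Or.inr (Or.inr (Or.inl rfl)))

theorem conj_y_x : gen 1 * gen 0 * (gen 1)⁻¹ = (gen 0)⁻¹ :=
  mul_inv_eq_one.mp (mk_eq_one (Or.inr (Or.inr (Or.inr (Or.inl rfl)))))

theorem conj_x_z : gen 0 * gen 2 * (gen 0)⁻¹ = gen 0 ^ 2 * gen 1 * (gen 2)⁻¹ :=
  mul_inv_eq_one.mp (mk_eq_one (Or.inr (Or.inr (Or.inr (Or.inr (Or.inl rfl))))))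

theorem conj_z_x_sq : gen 2 * gen 0 ^ 2 * (gen 2)⁻¹ = gen 1 :=
  mul_inv_eq_one.mp (mk_eq_one (Or.inr (Or.inr (Or.inr (Or.inr (Or.inr rfl))))))

theorem y_mul_x : gen 1 * gen 0 = gen 0 ^ 7 * gen 1 := by
  have h : (gen 0)⁻¹ = gen 0 ^ 7 := by
    rw [inv_eq_iff_mul_eq_one, ← pow_succ', x_pow_eight]
  rw [← h, ← conj_y_x, inv_mul_cancel_right]

theorem z_mul_x_sq : gen 2 * gen 0 ^ 2 = gen 1 * gen 2 := by
  rw [← conj_z_x_sq, inv_mul_cancel_right]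

theorem inv_z : (gen 2)⁻¹ = gen 2 ^ 2 := by
  rw [inv_eq_iff_mul_eq_one, ← pow_succ', z_pow_three]

theorem z_mul_x : gen 2 * gen 0 = gen 0 ^ 3 * gen 2 ^ 2 := by
  have h1 : gen 2 * (gen 0)⁻¹ = gen 0 * gen 1 * (gen 2)⁻¹ := by
    have := congrArg ((gen 0)⁻¹ * ·) conj_x_z
    simpa [mul_assoc, pow_two] using this
  calc gen 2 * gen 0 = gen 2 * gen 0 ^ 2 * (gen 0)⁻¹ := by group
    _ = gen 1 * (gen 0 * gen 1 * (gen 2)⁻¹) := by rw [z_mul_x_sq, mul_assoc, h1]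
    _ = gen 1 * gen 0 * gen 1 * gen 2 ^ 2 := by rw [inv_z]; simp only [mul_assoc]
    _ = gen 0 ^ 7 * gen 1 ^ 2 * gen 2 ^ 2 := by rw [y_mul_x, pow_two (gen 1)]; simp only [mul_assoc]
    _ = gen 0 ^ 8 * gen 0 ^ 3 * gen 2 ^ 2 := by rw [y_sq, ← pow_add, ← pow_add]
    _ = _ := by rw [x_pow_eight, one_mul]

theorem z_mul_y : gen 2 * gen 1 = gen 0 ^ 2 * gen 1 * gen 2 := by
  have h : gen 1 * gen 2 = gen 0 ^ 6 * (gen 2 * gen 1) := by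
    calc gen 1 * gen 2 = gen 2 * gen 0 * gen 0 := by rw [← z_mul_x_sq, pow_two, mul_assoc]
      _ = gen 0 ^ 3 * gen 2 * (gen 2 * gen 0) := by
        conv_lhs => rw [z_mul_x, pow_two (gen 2)]
        simp only [mul_assoc]
      _ = gen 0 ^ 3 * (gen 2 * gen 0) * gen 0 ^ 2 * gen 2 ^ 2 := by
        conv_lhs => rw [z_mul_x, pow_succ' (gen 0) 2]
        simp only [mul_assoc]
        rw [pow_succ' (gen 0) 2]
        simp only [mul_assoc]
      _ = gen 0 ^ 3 * gen 0 ^ 3 * gen 2 * (gen 2 * gen 0 ^ 2) * gen 2 ^ 2 := by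
        rw [z_mul_x, pow_two (gen 2)]; simp only [mul_assoc]
      _ = gen 0 ^ 6 * (gen 2 * gen 1) * gen 2 ^ 3 := by
        rw [z_mul_x_sq, ← pow_add, pow_succ' (gen 2) 2]; simp only [mul_assoc]
      _ = _ := by rw [z_pow_three, mul_one]
  rw [mul_assoc, h, ← mul_assoc, ← pow_add, x_pow_eight, one_mul]

/-- The elements of the form `x ^ i * y ^ j * z ^ k`. -/
def IsNormalForm (g : TwistedGL23) : Prop := ∃ i j k : ℕ, g = gen 0 ^ i * gen 1 ^ j * gen 2 ^ k

theorem IsNormalForm.x_mul {g : TwistedGL23} (hg : IsNormalForm g) : IsNormalForm (gen 0 * g) := by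
  obtain ⟨i, j, k, rfl⟩ := hg
  exact ⟨i + 1, j, k, by rw [pow_succ']; simp only [mul_assoc]⟩

theorem IsNormalForm.y_mul {g : TwistedGL23} (hg : IsNormalForm g) : IsNormalForm (gen 1 * g) := by
  obtain ⟨i, j, k, rfl⟩ := hg
  have h : gen 1 * gen 0 ^ i = (gen 0 ^ 7) ^ i * gen 1 :=
    ((show SemiconjBy (gen 1) (gen 0) (gen 0 ^ 7) from y_mul_x).pow_right i)
  refine ⟨7 * i, j + 1, k, ?_⟩
  rw [← mul_assoc, ← mul_assoc, h, pow_mul, pow_succ' (gen 1) j]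
  simp only [mul_assoc]

theorem IsNormalForm.pow_mul_of_forall {a g : TwistedGL23}
    (ha : ∀ g, IsNormalForm g → IsNormalForm (a * g)) (n : ℕ) (hg : IsNormalForm g) :
    IsNormalForm (a ^ n * g) := by
  induction n with
  | zero => simpa using hg
  | succ n ih =>
    rw [pow_succ', mul_assoc]
    exact ha _ ih

theorem IsNormalForm.z_mul {g : TwistedGL23} (hg : IsNormalForm g) : IsNormalForm (gen 2 * g) := by
  obtain ⟨i, j, k, rfl⟩ := hg
  have hx : ∀ m, gen 2 * gen 0 ^ (2 * m) = gen 1 ^ m * gen 2 := fun m => by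
    rw [pow_mul]
    exact (show SemiconjBy (gen 2) (gen 0 ^ 2) (gen 1) from z_mul_x_sq).pow_right m
  have hy : ∀ j, gen 2 * gen 1 ^ j = (gen 0 ^ 2 * gen 1) ^ j * gen 2 := fun j =>
    (show SemiconjBy (gen 2) (gen 1) (gen 0 ^ 2 * gen 1) from z_mul_y).pow_right j
  have hpure : ∀ k, IsNormalForm (gen 2 ^ k) := fun k => ⟨0, 0, k, by simp⟩
  have hxy : ∀ g, IsNormalForm g → IsNormalForm (gen 0 ^ 2 * gen 1 * g) := fun g hg => by
    rw [mul_assoc]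
    exact hg.y_mul.pow_mul_of_forall (fun _ h => h.x_mul) 2
  -- `z` moves past `x²` and `y` within the normal subgroup they generate.
  have hzy : ∀ j k, IsNormalForm (gen 2 * (gen 1 ^ j * gen 2 ^ k)) := fun j k => by
    rw [← mul_assoc, hy, mul_assoc, ← pow_succ']
    exact (hpure _).pow_mul_of_forall hxy j
  obtain ⟨m, rfl | rfl⟩ := i.even_or_odd'
  · rw [mul_assoc, ← mul_assoc, hx, mul_assoc]
    exact (hzy j k).pow_mul_of_forall (fun _ h => h.y_mul) m
  · have h2 : gen 2 ^ 2 * (gen 1 ^ j * gen 2 ^ k) = gen 0 ^ (2 * j) * gen 2 ^ (k + 2) := by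
      have hconj : SemiconjBy (gen 2 ^ 2) (gen 1) (gen 0 ^ 2) := by
        change gen 2 ^ 2 * gen 1 = gen 0 ^ 2 * gen 2 ^ 2
        have h0 : gen 1 * gen 0 ^ 2 * gen 1 = gen 0 ^ 2 := by
          have : gen 1 * gen 0 ^ 2 = (gen 0 ^ 7) ^ 2 * gen 1 :=
            (show SemiconjBy (gen 1) (gen 0) (gen 0 ^ 7) from y_mul_x).pow_right 2
          rw [this, mul_assoc, ← pow_two, y_sq, ← pow_mul, ← pow_add,
            show 7 * 2 + 4 = 8 * 2 + 2 from rfl, pow_add, pow_mul, x_pow_eight, one_pow, one_mul]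
        calc gen 2 ^ 2 * gen 1 = gen 2 * gen 0 ^ 2 * gen 1 * gen 2 := by
              rw [pow_two, mul_assoc, z_mul_y]; simp only [mul_assoc]
          _ = gen 1 * (gen 2 * gen 1) * gen 2 := by rw [z_mul_x_sq, mul_assoc (gen 1)]
          _ = gen 1 * gen 0 ^ 2 * gen 1 * (gen 2 * gen 2) := by rw [z_mul_y]; simp only [mul_assoc]
          _ = _ := by rw [h0, pow_two (gen 2)]
      rw [← mul_assoc, (hconj.pow_right j).eq, pow_mul, mul_assoc, ← pow_add, add_comm 2 k]
    have h3 : gen 2 * (gen 0 ^ (2 * m + 1) * gen 1 ^ j * gen 2 ^ k) =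
        gen 1 ^ m * (gen 0 ^ 3 * (gen 0 ^ (2 * j) * gen 2 ^ (k + 2))) := by
      calc gen 2 * (gen 0 ^ (2 * m + 1) * gen 1 ^ j * gen 2 ^ k)
          = (gen 2 * gen 0 ^ (2 * m)) * gen 0 * (gen 1 ^ j * gen 2 ^ k) := by
            rw [pow_succ]; simp only [mul_assoc]
        _ = gen 1 ^ m * (gen 2 * gen 0) * (gen 1 ^ j * gen 2 ^ k) := by
            rw [hx]; simp only [mul_assoc]
        _ = gen 1 ^ m * (gen 0 ^ 3 * (gen 2 ^ 2 * (gen 1 ^ j * gen 2 ^ k))) := by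
            rw [z_mul_x]; simp only [mul_assoc]
        _ = _ := by rw [h2]
    rw [h3]
    exact (((hpure _).pow_mul_of_forall (fun _ h => h.x_mul) _).pow_mul_of_forall
      (fun _ h => h.x_mul) _).pow_mul_of_forall (fun _ h => h.y_mul) m

/-- Left multiplication by the generators and their inverses preserves the elements in normal
form. -/
theorem isNormalForm (g : TwistedGL23) : IsNormalForm g := by
  have hmul : ∀ i g, IsNormalForm g → IsNormalForm (gen i * g) := fun i g hg => by
    fin_cases i
    exacts [hg.x_mul, hg.y_mul, hg.z_mul]
  have hinv : ∀ i, ∃ n, (gen i)⁻¹ = gen i ^ n := fun i => by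
    fin_cases i
    · exact ⟨7, by rw [inv_eq_iff_mul_eq_one, ← pow_succ']; exact x_pow_eight⟩
    · refine ⟨3, ?_⟩
      rw [inv_eq_iff_mul_eq_one, ← pow_succ']
      change gen 1 ^ (2 * 2) = 1
      rw [pow_mul, y_sq, ← pow_mul]
      exact x_pow_eight
    · exact ⟨2, inv_z⟩
  have hg : g ∈ Subgroup.closure (Set.range (PresentedGroup.of (rels := rels))) := by
    rw [PresentedGroup.closure_range_of]
    trivial
  induction hg using Subgroup.closure_induction_left with
  | one => exact ⟨0, 0, 0, by simp⟩
  | mul_left x hx y _ ih =>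
    obtain ⟨i, rfl⟩ := hx
    exact hmul i y ih
  | inv_mul_cancel x hx y _ ih =>
    obtain ⟨i, rfl⟩ := hx
    obtain ⟨n, hn⟩ := hinv i
    change IsNormalForm ((gen i)⁻¹ * y)
    rw [hn]
    exact ih.pow_mul_of_forall (hmul i) n

theorem normalForm_surjective : Function.Surjective fun p : Fin 8 × Fin 2 × Fin 3 =>
    gen 0 ^ (p.1 : ℕ) * gen 1 ^ (p.2.1 : ℕ) * gen 2 ^ (p.2.2 : ℕ) := by
  intro g
  obtain ⟨i, j, k, rfl⟩ := isNormalForm g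
  refine ⟨(⟨(i + 4 * (j / 2)) % 8, Nat.mod_lt _ (by norm_num)⟩,
    ⟨j % 2, Nat.mod_lt _ (by norm_num)⟩, ⟨k % 3, Nat.mod_lt _ (by norm_num)⟩), ?_⟩
  have hx : gen 0 ^ ((i + 4 * (j / 2)) % 8) = gen 0 ^ (i + 4 * (j / 2)) :=
    (pow_eq_pow_mod _ x_pow_eight).symm
  have hz : gen 2 ^ (k % 3) = gen 2 ^ k := (pow_eq_pow_mod _ z_pow_three).symm
  have hy : gen 1 ^ j = gen 0 ^ (4 * (j / 2)) * gen 1 ^ (j % 2) := by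
    conv_lhs => rw [← Nat.div_add_mod j 2, pow_add, pow_mul, y_sq, ← pow_mul]
  simp only
  rw [hx, hz, hy, pow_add]
  simp only [mul_assoc]

instance : Finite TwistedGL23 := Finite.of_surjective _ normalForm_surjective

theorem card_le : Nat.card TwistedGL23 ≤ 48 := by
  have := Nat.card_le_card_of_surjective _ normalForm_surjective
  simpa using this

/-- The images of the generators in `SL₂(7)`. -/
def slSevenGen : Fin 3 → SpecialLinearGroup (Fin 2) (ZMod 7) :=
  ![⟨!![0, 1; 6, 3], by decide⟩, ⟨!![1, 5; 1, 6], by decide⟩, ⟨!![2, 0; 2, 4], by decide⟩]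

/-- The representation of the presented group by matrices over `𝔽₇`. -/
def toSlSeven : TwistedGL23 →* SpecialLinearGroup (Fin 2) (ZMod 7) :=
  PresentedGroup.toGroup (f := slSevenGen) (by
    rintro r (rfl | rfl | rfl | rfl | rfl | rfl) <;>
    simp only [map_mul, map_pow, map_inv, FreeGroup.lift_apply_of] <;> decide +kernel)

theorem toSlSeven_gen (i : Fin 3) : toSlSeven (gen i) = slSevenGen i := PresentedGroup.toGroup.of _

theorem exists_toSlSeven_apply (v : Fin 2 → ZMod 7) (hv : v ≠ 0) :
    ∃ g, slPerm _ (toSlSeven g) ![1, 0] = v := by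
  have : ∀ v : Fin 2 → ZMod 7, v ≠ 0 → ∃ (k : Fin 3) (j : Fin 2) (i : Fin 8),
      slPerm _ (slSevenGen 0 ^ i.1 * slSevenGen 1 ^ j.1 * slSevenGen 2 ^ k.1) ![1, 0] = v := by
    decide +kernel
  obtain ⟨k, j, i, h⟩ := this v hv
  refine ⟨gen 0 ^ (i : ℕ) * gen 1 ^ (j : ℕ) * gen 2 ^ (k : ℕ), ?_⟩
  simpa only [map_mul, map_pow, toSlSeven_gen] using h

/-- The group has at most `48` elements and is transitive on the `48` nonzero vectors, so its action
is regular. -/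
theorem bijective_toSlSeven_apply : Function.Bijective
    fun g : TwistedGL23 => (⟨slPerm _ (toSlSeven g) ![1, 0], fun h => by
      rw [← Matrix.mulVec_zero (toSlSeven g).1] at h
      exact absurd (congrFun ((slPerm _ (toSlSeven g)).injective h) 0) (by decide)⟩ :
        {v : Fin 2 → ZMod 7 // v ≠ 0}) := by
  refine Function.Surjective.bijective_of_nat_card_le ?_ ?_
  · rintro ⟨v, hv⟩
    obtain ⟨g, hg⟩ := exists_toSlSeven_apply v hv
    exact ⟨g, Subtype.ext hg⟩
  · refine card_le.trans (le_of_eq ?_)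
    rw [Nat.card_eq_fintype_card, Fintype.card_subtype_compl, Fintype.card_fun]
    simp [ZMod.card]

theorem toSlSeven_injective : Function.Injective toSlSeven := fun g h hgh =>
  bijective_toSlSeven_apply.1 (Subtype.ext (by simp only [hgh]))

theorem card_eq : Nat.card TwistedGL23 = 48 := by
  rw [Nat.card_eq_of_bijective _ bijective_toSlSeven_apply, Nat.card_eq_fintype_card,
    Fintype.card_subtype_compl, Fintype.card_fun]
  simp [ZMod.card]

/-- The images of the generators in `SL₂(2)`. -/
def slTwoGen : Fin 3 → SpecialLinearGroup (Fin 2) (ZMod 2) :=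
  ![⟨!![0, 1; 1, 0], by decide⟩, 1, ⟨!![0, 1; 1, 1], by decide⟩]

/-- The quotient map onto `SL₂(2) ≅ S₃`, whose kernel is the quaternion group generated by `x²`
and `y`. -/
def toSlTwo : TwistedGL23 →* SpecialLinearGroup (Fin 2) (ZMod 2) :=
  PresentedGroup.toGroup (f := slTwoGen) (by
    rintro r (rfl | rfl | rfl | rfl | rfl | rfl) <;>
    simp only [map_mul, map_pow, map_inv, FreeGroup.lift_apply_of] <;> decide +kernel)

theorem toSlTwo_gen (i : Fin 3) : toSlTwo (gen i) = slTwoGen i := PresentedGroup.toGroup.of _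

theorem toSlTwo_surjective : Function.Surjective toSlTwo := by
  have : ∀ M, ∃ (i : Fin 2) (k : Fin 3), slTwoGen 0 ^ i.1 * slTwoGen 2 ^ k.1 = M := by
    decide +kernel
  intro M
  obtain ⟨i, k, h⟩ := this M
  refine ⟨gen 0 ^ (i : ℕ) * gen 2 ^ (k : ℕ), ?_⟩
  rw [map_mul, map_pow, map_pow, toSlTwo_gen, toSlTwo_gen, h]

instance : Group.IsSolvable TwistedGL23 := by
  refine isSolvable_of_isPGroup_ker 2 toSlTwo (IsPGroup.of_card (n := 3) ?_)
  have h1 := Subgroup.card_mul_index toSlTwo.ker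
  rw [Subgroup.index_ker, MonoidHom.range_eq_top.mpr toSlTwo_surjective, card_eq] at h1
  have h2 : Nat.card (⊤ : Subgroup (SpecialLinearGroup (Fin 2) (ZMod 2))) = 6 := by
    rw [Subgroup.card_top, Nat.card_eq_fintype_card]
    decide +kernel
  rw [h2] at h1
  omega

end TwistedGL23

theorem isRealized_seven_twistedGL23 :
    IsRealized 7 (fun G _ E _ => Nonempty (G ⧸ E ≃* TwistedGL23)) :=
  isRealized_of_transitive (by norm_num) (τ := 4) (by decide) TwistedGL23.toSlSeven
    TwistedGL23.toSlSeven_injective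
    (transitive_of_base ((slPerm _).comp TwistedGL23.toSlSeven) ![1, 0]
      TwistedGL23.exists_toSlSeven_apply)
    (MulEquiv.refl _)

end

/-! ### Pauli matrices and the diagonals of the cube -/

section

open Matrix

/-- The Pauli matrices `X ^ v₀ * Z ^ v₁`, up to phases. -/
def pauli (v : Fin 2 → ZMod 2) : Matrix (Fin 2) (Fin 2) ℂ :=
  !![0, 1; 1, 0] ^ (v 0).val * !![1, 0; 0, -1] ^ (v 1).val

/-- The sign picked up when reordering `X ^ u₀ Z ^ u₁ X ^ v₀ Z ^ v₁`. -/
def pauliCocycle (u v : Fin 2 → ZMod 2) : ℂ := (-1) ^ ((u 1).val * (v 0).val)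

theorem zmodTwo_vec_cases (v : Fin 2 → ZMod 2) :
    v = 0 ∨ v = ![1, 0] ∨ v = ![0, 1] ∨ v = ![1, 1] := by
  revert v
  decide

theorem pauli_zero : pauli 0 = 1 := by simp [pauli]

theorem pauli_x : pauli ![1, 0] = !![0, 1; 1, 0] := by
  simp [pauli, show (1 : ZMod 2).val = 1 from rfl]

theorem pauli_z : pauli ![0, 1] = !![1, 0; 0, -1] := by
  simp [pauli, show (1 : ZMod 2).val = 1 from rfl]

theorem pauli_xz : pauli ![1, 1] = !![0, -1; 1, 0] := by
  simp [pauli, show (1 : ZMod 2).val = 1 from rfl]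

theorem isWeylSystem_pauli : IsWeylSystem pauliCocycle pauli where
  mem_unitary v := by
    rw [mem_unitaryGroup_iff, star_eq_conjTranspose]
    rcases zmodTwo_vec_cases v with rfl | rfl | rfl | rfl
    · simp [pauli_zero]
    all_goals
      simp only [pauli_x, pauli_z, pauli_xz]
      ext i j
      fin_cases i <;> fin_cases j <;> simp [Matrix.mul_apply]
  zero := pauli_zero
  mul u v := by
    have h1 : (1 : ZMod 2).val = 1 := rfl
    have h2 : (1 : ZMod 2) + 1 = 0 := by decide
    have h3 : pauli ![0, 0] = 1 := by simp [pauli]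
    rcases zmodTwo_vec_cases u with rfl | rfl | rfl | rfl <;>
    rcases zmodTwo_vec_cases v with rfl | rfl | rfl | rfl <;>
    simp [pauliCocycle, h1, h2, h3, pauli_zero, pauli_x, pauli_z, pauli_xz, Matrix.one_fin_two]
  star_cocycle_mul u v := by
    rw [pauliCocycle, star_pow, ← mul_pow]
    simp
  trace_eq_zero v hv := by
    rcases zmodTwo_vec_cases v with rfl | rfl | rfl | rfl
    · exact absurd rfl hv
    all_goals simp [pauli_x, pauli_z, pauli_xz, Matrix.trace_fin_two]
  card_eq := by simp

/-- The sum of the three Pauli matrices: a main diagonal of the cube on which the Clifford group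
acts. -/
def cubeDiagonal : Matrix (Fin 2) (Fin 2) ℂ := !![1, 1 - Complex.I; 1 + Complex.I, -1]

/-- Some unitary matrix induces `M` on the Pauli matrices, up to phases, and preserves the cube
diagonal up to sign. -/
def HasDiagonalLift (M : SpecialLinearGroup (Fin 2) (ZMod 2)) : Prop :=
  ∃ U ∈ unitaryGroup (Fin 2) ℂ, (∀ v, ∃ c : ℂ, U * pauli v = c • (pauli (slPerm _ M v) * U)) ∧
    ∃ c : ℂ, U * cubeDiagonal = c • (cubeDiagonal * U)

theorem HasDiagonalLift.mul {M N : SpecialLinearGroup (Fin 2) (ZMod 2)} (hM : HasDiagonalLift M)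
    (hN : HasDiagonalLift N) : HasDiagonalLift (M * N) := by
  obtain ⟨U, hU, hUP, a, ha⟩ := hM
  obtain ⟨W, hW, hWP, b, hb⟩ := hN
  refine ⟨U * W, mul_mem hU hW, fun v => ?_, b * a, ?_⟩
  · obtain ⟨c, hc⟩ := hWP v
    obtain ⟨d, hd⟩ := hUP (slPerm _ N v)
    refine ⟨c * d, ?_⟩
    rw [mul_assoc, hc, mul_smul_comm, ← mul_assoc, hd, smul_mul_assoc, smul_smul, mul_assoc,
      map_mul]
    rfl
  · rw [mul_assoc, hb, mul_smul_comm, ← mul_assoc, ha, smul_mul_assoc, smul_smul, mul_assoc]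

/-- The element of order three of `SL₂(2)` induced by the rotation about the cube diagonal. -/
def slTwoRotation : SpecialLinearGroup (Fin 2) (ZMod 2) := ⟨!![1, 1; 1, 0], by decide⟩

/-- The transvection of `SL₂(2)` exchanging the two basis vectors. -/
def slTwoSwap : SpecialLinearGroup (Fin 2) (ZMod 2) := ⟨!![0, 1; 1, 0], by decide⟩

theorem hasDiagonalLift_one : HasDiagonalLift 1 :=
  ⟨1, one_mem _, fun v => ⟨1, by simp⟩, 1, by simp⟩

theorem hasDiagonalLift_rotation : HasDiagonalLift slTwoRotation := by
  have hI := Complex.I_sq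
  -- The rotation `(1 - i (X + Y + Z)) / 2` by a third of a turn.
  refine ⟨(1 / 2 : ℂ) • !![1 - Complex.I, -1 - Complex.I; 1 - Complex.I, 1 + Complex.I],
    ?_, fun v => ?_, 1, ?_⟩
  · rw [mem_unitaryGroup_iff, star_eq_conjTranspose]
    ext i j
    fin_cases i <;> fin_cases j <;> simp [Matrix.mul_apply] <;> ring_nf <;>
      simp [hI, map_ofNat] <;> norm_num
  · rcases zmodTwo_vec_cases v with rfl | rfl | rfl | rfl
    · refine ⟨1, ?_⟩
      rw [show slPerm _ slTwoRotation 0 = 0 by decide, pauli_zero, mul_one, one_mul, one_smul]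
    · refine ⟨Complex.I, ?_⟩
      rw [show slPerm _ slTwoRotation ![1, 0] = ![1, 1] by decide, pauli_x, pauli_xz]
      ext i j
      fin_cases i <;> fin_cases j <;> simp [Matrix.mul_apply] <;> ring_nf <;> simp [hI] <;> ring
    · refine ⟨1, ?_⟩
      rw [show slPerm _ slTwoRotation ![0, 1] = ![1, 0] by decide, pauli_x, pauli_z]
      ext i j
      fin_cases i <;> fin_cases j <;> simp [Matrix.mul_apply] <;> ring_nf
    · refine ⟨-Complex.I, ?_⟩
      rw [show slPerm _ slTwoRotation ![1, 1] = ![0, 1] by decide, pauli_xz, pauli_z]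
      ext i j
      fin_cases i <;> fin_cases j <;> simp [Matrix.mul_apply] <;> ring_nf <;> simp [hI] <;> ring
  · rw [cubeDiagonal]
    ext i j
    fin_cases i <;> fin_cases j <;> simp [Matrix.mul_apply] <;> ring_nf <;> simp [hI] <;> ring

theorem hasDiagonalLift_swap : HasDiagonalLift slTwoSwap := by
  have hs : ((Real.sqrt 2 : ℝ) : ℂ)⁻¹ * ((Real.sqrt 2 : ℝ) : ℂ)⁻¹ = 1 / 2 := by
    rw [← mul_inv, ← Complex.ofReal_mul, Real.mul_self_sqrt (by norm_num)]
    norm_num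
  -- The reflection `(Z - X) / √2`, which reverses the diagonal.
  refine ⟨(((Real.sqrt 2 : ℝ) : ℂ)⁻¹) • !![1, -1; -1, -1], ?_, fun v => ?_, -1, ?_⟩
  · rw [mem_unitaryGroup_iff, star_smul, smul_mul_smul_comm, star_inv₀, Complex.star_def,
      Complex.conj_ofReal, hs, star_eq_conjTranspose]
    rw [show (!![1, -1; -1, -1] : Matrix (Fin 2) (Fin 2) ℂ)ᴴ = !![1, -1; -1, -1] by
      ext i j
      fin_cases i <;> fin_cases j <;> simp]
    ext i j
    fin_cases i <;> fin_cases j <;> simp <;> norm_num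
  · rcases zmodTwo_vec_cases v with rfl | rfl | rfl | rfl
    · refine ⟨1, ?_⟩
      rw [show slPerm _ slTwoSwap 0 = 0 by decide, pauli_zero, mul_one, one_mul, one_smul]
    · refine ⟨-1, ?_⟩
      rw [show slPerm _ slTwoSwap ![1, 0] = ![0, 1] by decide, pauli_x, pauli_z]
      ext i j
      fin_cases i <;> fin_cases j <;> simp
    · refine ⟨-1, ?_⟩
      rw [show slPerm _ slTwoSwap ![0, 1] = ![1, 0] by decide, pauli_x, pauli_z]
      ext i j
      fin_cases i <;> fin_cases j <;> simp [Matrix.mul_apply]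
    · refine ⟨-1, ?_⟩
      rw [show slPerm _ slTwoSwap ![1, 1] = ![1, 1] by decide, pauli_xz]
      ext i j
      fin_cases i <;> fin_cases j <;> simp [Matrix.mul_apply]
  · rw [cubeDiagonal]
    ext i j
    fin_cases i <;> fin_cases j <;> simp [Matrix.mul_apply] <;> ring

/-- The rotations preserving the diagonal up to sign form a dihedral group of order six, which maps
onto `SL₂(2)`. -/
theorem hasDiagonalLift (M : SpecialLinearGroup (Fin 2) (ZMod 2)) : HasDiagonalLift M := by
  have hgen : ∀ M, M = 1 ∨ M = slTwoRotation ∨ M = slTwoRotation * slTwoRotation ∨ M = slTwoSwap ∨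
      M = slTwoSwap * slTwoRotation ∨ M = slTwoSwap * (slTwoRotation * slTwoRotation) := by
    decide +kernel
  have h1 := hasDiagonalLift_rotation
  have h2 := hasDiagonalLift_swap
  rcases hgen M with rfl | rfl | rfl | rfl | rfl | rfl
  exacts [hasDiagonalLift_one, h1, h1.mul h1, h2, h2.mul h1, h2.mul (h1.mul h1)]

/-- No Pauli matrix other than the identity preserves the cube diagonal up to a scalar. -/
theorem eq_zero_of_pauli_mul_cubeDiagonal {v : Fin 2 → ZMod 2} {c : ℂ}
    (h : pauli v * cubeDiagonal = c • (cubeDiagonal * pauli v)) : v = 0 := by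
  have h00 := congrFun (congrFun h 0) 0
  have h01 := congrFun (congrFun h 0) 1
  rcases zmodTwo_vec_cases v with rfl | rfl | rfl | rfl
  · rfl
  all_goals exfalso
  · simp [pauli_x, cubeDiagonal, Matrix.mul_apply] at h00 h01
    rw [← h01] at h00
    have := congrArg Complex.re h00
    norm_num at this
  · simp [pauli_z, cubeDiagonal, Matrix.mul_apply] at h00 h01
    rw [← h00] at h01
    have := congrArg Complex.re h01
    norm_num at this
  · simp [pauli_xz, cubeDiagonal, Matrix.mul_apply] at h00 h01
    rw [show c = -1 by rw [h01, neg_neg]] at h00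
    have := congrArg Complex.im h00
    norm_num at this

section CubeGroup

variable {H : Type} [Group H] (φ : H →* SpecialLinearGroup (Fin 2) (ZMod 2))

theorem hasUnitaryLifts_pauli : IsWeylSystem.HasUnitaryLifts pauli ((slPerm _).comp φ) := by
  intro h
  obtain ⟨U, hU, hUP, -⟩ := hasDiagonalLift (φ h)
  refine ⟨U, hU, fun v => ?_⟩
  obtain ⟨c, hc⟩ := hUP v
  exact ⟨c, by rw [hc, smul_mul_assoc, mul_assoc, hU.2, mul_one]; rfl⟩

/-- The group of pairs `(U, h)` for the Pauli matrices: a subgroup of the binary octahedral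
group. -/
abbrev CubeGroup : Type := isWeylSystem_pauli.liftGroup ((slPerm _).comp φ)

/-- The projection of the cube group to `H`. -/
abbrev cubeProj : CubeGroup φ →* H := isWeylSystem_pauli.proj ((slPerm _).comp φ)

/-- The matrix of an element of the cube group. -/
abbrev cubeMat : CubeGroup φ →* Matrix (Fin 2) (Fin 2) ℂ :=
  isWeylSystem_pauli.mat ((slPerm _).comp φ)

/-- The stabilizer of the cube diagonal, up to sign. -/
def diagonalStabilizer : Subgroup (CubeGroup φ) where
  carrier := {g | ∃ c : ℂ, cubeMat φ g * cubeDiagonal = c • (cubeDiagonal * cubeMat φ g)}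
  one_mem' := ⟨1, by simp⟩
  mul_mem' {g g'} := by
    rintro ⟨a, ha⟩ ⟨b, hb⟩
    refine ⟨b * a, ?_⟩
    rw [map_mul, mul_assoc, hb, mul_smul_comm, ← mul_assoc, ha, smul_mul_assoc, smul_smul,
      mul_assoc]
  inv_mem' {g} := by
    rintro ⟨a, ha⟩
    have h1 := isWeylSystem_pauli.star_mat_mul_mat g
    have h2 := isWeylSystem_pauli.mat_mul_star_mat g
    have h3 : cubeDiagonal * star (cubeMat φ g) = a • (star (cubeMat φ g) * cubeDiagonal) := by
      calc cubeDiagonal * star (cubeMat φ g)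
          = star (cubeMat φ g) * (cubeMat φ g * cubeDiagonal) * star (cubeMat φ g) := by
            rw [← mul_assoc, h1, one_mul]
        _ = a • (star (cubeMat φ g) * cubeDiagonal * (cubeMat φ g * star (cubeMat φ g))) := by
            rw [ha, mul_smul_comm, smul_mul_assoc]; simp only [mul_assoc]
        _ = _ := by rw [h2, mul_one]
    have ha0 : a ≠ 0 := by
      rintro rfl
      have h4 : cubeDiagonal = 0 := by
        calc cubeDiagonal = cubeDiagonal * star (cubeMat φ g) * cubeMat φ g := by
              rw [mul_assoc, h1, mul_one]
          _ = 0 := by rw [h3, zero_smul, zero_mul]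
      have := congrFun (congrFun h4 0) 0
      simp [cubeDiagonal] at this
    refine ⟨a⁻¹, ?_⟩
    change star (cubeMat φ g) * _ = a⁻¹ • (_ * star (cubeMat φ g))
    rw [h3, smul_smul, inv_mul_cancel₀ ha0, one_smul]

variable {φ} (hφ : Function.Injective φ)
include hφ

theorem comp_slPerm_injective : Function.Injective ((slPerm _).comp φ) :=
  (slPerm_injective _).comp hφ

/-- Pauli matrices move the diagonal, so the stabilizer of the diagonal meets their group in the
center. -/
theorem diagonalStabilizer_inf_ker :
    diagonalStabilizer φ ⊓ (cubeProj φ).ker = Subgroup.center (CubeGroup φ) := by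
  have hinj := comp_slPerm_injective hφ
  ext g
  rw [isWeylSystem_pauli.mem_center_iff hinj]
  constructor
  · rintro ⟨⟨c, hc⟩, hg⟩
    obtain ⟨u, a, ha, hu⟩ := isWeylSystem_pauli.mat_eq_smul_of_proj_eq_one hg
    rw [cubeMat, hu, smul_mul_assoc, mul_smul_comm, smul_comm] at hc
    have h0 := eq_zero_of_pauli_mul_cubeDiagonal (smul_right_injective _ ha hc)
    exact ⟨hg, a, by rw [hu, h0, pauli_zero]⟩
  · rintro ⟨hg, a, ha⟩
    exact ⟨⟨1, by rw [cubeMat, ha, smul_mul_assoc, mul_smul_comm, one_mul, mul_one, one_smul]⟩, hg⟩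

theorem relIndex_center_cubeProj_ker :
    (Subgroup.center (CubeGroup φ)).relIndex (cubeProj φ).ker = 4 := by
  rw [isWeylSystem_pauli.relIndex_center_ker (comp_slPerm_injective hφ)]
  rfl

theorem index_center_cubeGroup :
    (Subgroup.center (CubeGroup φ)).index = 4 * Nat.card H := by
  have h1 := Subgroup.relIndex_mul_index
    (isWeylSystem_pauli.center_le_ker (comp_slPerm_injective hφ))
  rw [relIndex_center_cubeProj_ker hφ] at h1
  rw [← h1, Subgroup.index_ker, MonoidHom.range_eq_top.mpr
    (isWeylSystem_pauli.proj_surjective (hasUnitaryLifts_pauli φ)), Subgroup.card_top]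

variable [Finite H]

/-- The stabilizer of the diagonal surjects onto `H`, so that its index is the number of Pauli
matrices. -/
theorem index_diagonalStabilizer : (diagonalStabilizer φ).index = 4 := by
  have hfin : Finite (CubeGroup φ) := isWeylSystem_pauli.finite_liftGroup
  have hsup : diagonalStabilizer φ ⊔ (cubeProj φ).ker = ⊤ := by
    refine Subgroup.eq_top_iff' _ |>.mpr fun g => ?_
    obtain ⟨U, hU, hUP, c, hc⟩ := hasDiagonalLift (φ (cubeProj φ g))
    obtain ⟨k, a, -, hk, hkp⟩ := isWeylSystem_pauli.exists_mem_liftGroup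
      (f := (slPerm _).comp φ) (h := cubeProj φ g) hU fun v => by
        obtain ⟨c, hc⟩ := hUP v
        exact ⟨c, by rw [hc, smul_mul_assoc, mul_assoc, hU.2, mul_one]; rfl⟩
    have hkL : k ∈ diagonalStabilizer φ :=
      ⟨c, by rw [cubeMat, hk, smul_mul_assoc, hc, mul_smul_comm, smul_comm]⟩
    have hE : k⁻¹ * g ∈ (cubeProj φ).ker := by
      rw [MonoidHom.mem_ker, map_mul, map_inv, cubeProj, hkp, inv_mul_cancel]
    have := mul_mem (Subgroup.mem_sup_left hkL) (Subgroup.mem_sup_right hE)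
    rwa [mul_inv_cancel_left] at this
  have h1 := Subgroup.relIndex_mul_index
    (inf_le_left : diagonalStabilizer φ ⊓ (cubeProj φ).ker ≤ diagonalStabilizer φ)
  have h2 := Subgroup.relIndex_mul_index
    (inf_le_right : diagonalStabilizer φ ⊓ (cubeProj φ).ker ≤ (cubeProj φ).ker)
  rw [Subgroup.inf_relIndex_left, ← Subgroup.relIndex_sup_right, hsup, Subgroup.relIndex_top_right,
    ← h2, diagonalStabilizer_inf_ker hφ, relIndex_center_cubeProj_ker hφ, mul_comm] at h1
  exact Nat.eq_of_mul_eq_mul_right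
    (Nat.pos_of_ne_zero (Subgroup.index_ne_zero_of_finite (H := (cubeProj φ).ker))) h1

/-- The action of the cube group on the four conjugates of the cube diagonal has the center as its
kernel. -/
theorem exists_hom_perm_four :
    ∃ Ψ : CubeGroup φ →* Equiv.Perm (Fin 4), Ψ.ker = Subgroup.center (CubeGroup φ) := by
  have hinj := comp_slPerm_injective hφ
  have hfin : Finite (CubeGroup φ) := isWeylSystem_pauli.finite_liftGroup
  let L := diagonalStabilizer φ
  have hcard : Nat.card (CubeGroup φ ⧸ L) = 4 := index_diagonalStabilizer hφ
  let e : CubeGroup φ ⧸ L ≃ Fin 4 := Finite.equivFinOfCardEq hcard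
  refine ⟨e.permCongrHom.toMonoidHom.comp (MulAction.toPermHom (CubeGroup φ) (CubeGroup φ ⧸ L)), ?_⟩
  have hker : (e.permCongrHom.toMonoidHom.comp
      (MulAction.toPermHom (CubeGroup φ) (CubeGroup φ ⧸ L))).ker = L.normalCore := by
    rw [Subgroup.normalCore_eq_ker]
    ext g
    simp [MonoidHom.mem_ker]
  rw [hker]
  refine le_antisymm (fun k hk => ?_) (Subgroup.normal_le_normalCore.mpr ?_)
  · rw [← diagonalStabilizer_inf_ker hφ]
    refine ⟨L.normalCore_le hk, ?_⟩
    -- Commutators of `k` with Pauli matrices stabilise the diagonal, hence are central, so `k`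
    -- fixes the index of every Pauli matrix.
    change cubeProj φ k = 1
    refine hinj (Equiv.ext fun u => ?_)
    obtain ⟨e, a, ha, he, he1⟩ := isWeylSystem_pauli.exists_mat_eq_smul ((slPerm _).comp φ) u
    have hcomm : k * (e * k⁻¹ * e⁻¹) ∈ L ⊓ (cubeProj φ).ker := by
      refine Subgroup.mem_inf.mpr ⟨mul_mem (L.normalCore_le hk)
        (L.normalCore_le (Subgroup.Normal.conj_mem inferInstance _ (inv_mem hk) e)), ?_⟩
      rw [MonoidHom.mem_ker, map_mul, map_mul, map_mul, map_inv, map_inv, cubeProj, he1]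
      simp
    rw [diagonalStabilizer_inf_ker hφ, isWeylSystem_pauli.mem_center_iff hinj] at hcomm
    obtain ⟨-, b, hb⟩ := hcomm
    obtain ⟨c, hc0, hc⟩ := isWeylSystem_pauli.mat_conj k u
    rw [map_one, Equiv.Perm.one_apply]
    have h1 : cubeMat φ (k * e * k⁻¹) = b • cubeMat φ e := by
      have : k * e * k⁻¹ = k * (e * k⁻¹ * e⁻¹) * e := by group
      rw [this, map_mul, cubeMat, hb, smul_mul_assoc, one_mul]
    rw [map_mul, map_mul, cubeMat, isWeylSystem_pauli.mat_inv, he, mul_smul_comm, smul_mul_assoc,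
      hc, smul_smul, smul_smul] at h1
    exact isWeylSystem_pauli.eq_of_smul_eq (mul_ne_zero ha hc0) h1
  · rw [← diagonalStabilizer_inf_ker hφ]
    exact inf_le_left

end CubeGroup

/-- The cyclic subgroup of order three of `SL₂(2)`. -/
def cyclicThreeToSl : Multiplicative (ZMod 3) →* SpecialLinearGroup (Fin 2) (ZMod 2) :=
  zmodPowersHom slTwoRotation (by decide +kernel)

/-- For the cyclic group of order three in `SL₂(2)`, the group of pairs is the binary tetrahedral
group; its image on the four diagonals of the cube has order `12`. -/
theorem isRealized_two_alternating :
    IsRealized 2 (fun G _ _ _ => Nonempty (G ⧸ Subgroup.center G ≃* alternatingGroup (Fin 4))) := by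
  have hinj : Function.Injective cyclicThreeToSl := by
    unfold Function.Injective
    decide +kernel
  refine isRealized_of_isWeylSystem isWeylSystem_pauli ((slPerm _).comp cyclicThreeToSl)
    (comp_slPerm_injective hinj) (hasUnitaryLifts_pauli _)
    (transitive_of_base _ ![1, 0] ?_) rfl (by norm_num) ?_
  · change ∀ v : Fin 2 → ZMod 2, v ≠ 0 → ∃ h, slPerm _ (cyclicThreeToSl h) ![1, 0] = v
    decide +kernel
  · obtain ⟨Ψ, hΨ⟩ := exists_hom_perm_four hinj
    have hcard : Nat.card Ψ.range = 12 := by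
      rw [← Subgroup.index_ker, hΨ, index_center_cubeGroup hinj, Nat.card_eq_fintype_card]
      rfl
    have hrange : Ψ.range = alternatingGroup (Fin 4) := by
      apply Equiv.Perm.eq_alternatingGroup_of_index_eq_two
      have := Subgroup.card_mul_index Ψ.range
      rw [hcard, Nat.card_eq_fintype_card, Fintype.card_perm, Fintype.card_fin] at this
      have h24 : Nat.factorial 4 = 24 := rfl
      omega
    exact ⟨(QuotientGroup.quotientMulEquivOfEq hΨ.symm).trans
      ((QuotientGroup.quotientKerEquivRange Ψ).trans (MulEquiv.subgroupCongr hrange))⟩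

/-- For all of `SL₂(2)`, the group of pairs is the binary octahedral group; its image on the four
diagonals of the cube has order `24`. -/
theorem isRealized_two_perm :
    IsRealized 2 (fun G _ _ _ => Nonempty (G ⧸ Subgroup.center G ≃* Equiv.Perm (Fin 4))) := by
  have hinj : Function.Injective (MonoidHom.id (SpecialLinearGroup (Fin 2) (ZMod 2))) :=
    Function.injective_id
  refine isRealized_of_isWeylSystem isWeylSystem_pauli ((slPerm _).comp (MonoidHom.id _))
    (comp_slPerm_injective hinj) (hasUnitaryLifts_pauli _)
    (transitive_of_base _ ![1, 0] ?_) rfl (by norm_num) ?_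
  · change ∀ v : Fin 2 → ZMod 2, v ≠ 0 → ∃ M, slPerm _ M ![1, 0] = v
    decide +kernel
  · obtain ⟨Ψ, hΨ⟩ := exists_hom_perm_four hinj
    have hcard : Nat.card Ψ.range = 24 := by
      rw [← Subgroup.index_ker, hΨ, index_center_cubeGroup hinj, Nat.card_eq_fintype_card]
      decide +kernel
    have hrange : Ψ.range = ⊤ := by
      apply Subgroup.eq_top_of_card_eq
      rw [hcard, Nat.card_eq_fintype_card, Fintype.card_perm, Fintype.card_fin]
      rfl
    exact ⟨(QuotientGroup.quotientMulEquivOfEq hΨ.symm).trans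
      (QuotientGroup.quotientKerEquivOfSurjective Ψ (MonoidHom.range_eq_top.mp hrange))⟩

end

/-! ### Extraspecial groups, central products and Fitting subgroups -/

section

open scoped commutatorElement

/-- A nonabelian `2`-group with center of order two and central commutators is extraspecial:
centralizers of noncentral elements have index two, hence are maximal, and they intersect in the
center; conversely a maximal subgroup missing the center would contain all commutators. -/
theorem isExtraspecial_two {P : Type*} [Group P] [Finite P] (h2 : IsPGroup 2 P)
    (hcard : Nat.card (Subgroup.center P) = 2) (hcomm : ∀ x y : P, ⁅x, y⁆ ∈ Subgroup.center P)
    (hne : ∃ x y : P, x * y ≠ y * x) : IsExtraspecial 2 P := by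
  have hle : commutator P ≤ Subgroup.center P :=
    Subgroup.commutator_le.mpr fun x _ y _ => hcomm x y
  have hmem : ∀ x y : P, ⁅x, y⁆ ∈ commutator P := fun x y =>
    Subgroup.commutator_mem_commutator (Subgroup.mem_top x) (Subgroup.mem_top y)
  have heq : commutator P = Subgroup.center P := by
    have hdvd := Subgroup.card_dvd_of_le hle
    rw [hcard] at hdvd
    have hone : Nat.card (commutator P) ≠ 1 := fun h1 => by
      obtain ⟨x, y, hxy⟩ := hne
      have h3 := hmem x y
      rw [Subgroup.card_eq_one.mp h1, Subgroup.mem_bot, commutatorElement_eq_one_iff_mul_comm] at h3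
      exact hxy h3
    have htwo := ((Nat.dvd_prime Nat.prime_two).mp hdvd).resolve_left hone
    exact Subgroup.eq_of_le_of_card_ge hle (by rw [hcard, htwo])
  obtain ⟨z, hz⟩ : ∃ z : P, ∀ w ∈ Subgroup.center P, w = 1 ∨ w = z := by
    obtain ⟨a, b, -, hab⟩ := Nat.card_eq_two_iff.mp hcard
    have hall : ∀ w : Subgroup.center P, w = a ∨ w = b := fun w => by
      have : w ∈ ({a, b} : Set (Subgroup.center P)) := by rw [hab]; trivial
      simpa using this
    rcases hall 1 with h | h
    · refine ⟨b, fun w hw => ?_⟩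
      rcases hall ⟨w, hw⟩ with h' | h'
      · exact Or.inl (congrArg Subtype.val (h'.trans h.symm))
      · exact Or.inr (congrArg Subtype.val h')
    · refine ⟨a, fun w hw => ?_⟩
      rcases hall ⟨w, hw⟩ with h' | h'
      · exact Or.inr (congrArg Subtype.val h')
      · exact Or.inl (congrArg Subtype.val (h'.trans h.symm))
  refine ⟨h2, hcard, heq, le_antisymm (fun g hg => ?_) (le_iInf₂ fun M hM => ?_)⟩
  · rw [Subgroup.mem_center_iff]
    intro x
    by_cases hx : x ∈ Subgroup.center P
    · exact (Subgroup.mem_center_iff.mp hx g).symm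
    let C : Subgroup P := Subgroup.centralizer {x}
    have hC : ∀ p, p ∈ C ↔ p * x = x * p := fun p =>
      Subgroup.mem_centralizer_singleton_iff
    have hcoatom : IsCoatom C := by
      refine ⟨fun htop => hx (Subgroup.mem_center_iff.mpr fun p => (hC p).mp ?_), fun K hK => ?_⟩
      · rw [htop]; trivial
      obtain ⟨y, hyK, hyC⟩ := SetLike.exists_of_lt hK
      -- Two elements outside the centralizer have the same commutator with `x`.
      have hout : ∀ p, p ∉ C → p * x * p⁻¹ = z * x := fun p hp => by
        have h3 := (hz _ (hcomm p x)).resolve_left fun h1 =>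
          hp ((hC p).mpr (commutatorElement_eq_one_iff_mul_comm.mp h1))
        rw [← h3, commutatorElement_def, inv_mul_cancel_right]
      refine Subgroup.eq_top_iff' _ |>.mpr fun p => ?_
      by_cases hp : p ∈ C
      · exact hK.le hp
      · have h3 : y⁻¹ * p ∈ C := by
          rw [hC]
          have h4 : p * x * p⁻¹ = y * x * y⁻¹ := (hout p hp).trans (hout y hyC).symm
          calc y⁻¹ * p * x = y⁻¹ * (p * x * p⁻¹) * p := by group
            _ = x * (y⁻¹ * p) := by rw [h4]; group
        simpa using K.mul_mem hyK (hK.le h3)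
    exact ((hC g).mp (frattini_le_coatom hcoatom hg)).symm
  · by_contra hMZ
    have hsup : M ⊔ Subgroup.center P = ⊤ := hM.2 _ (left_lt_sup.mpr hMZ)
    have hdec : ∀ p : P, ∃ m ∈ M, ∃ c ∈ Subgroup.center P, m * c = p := fun p =>
      Subgroup.mem_sup_of_normal_right.mp (by rw [hsup]; trivial)
    apply hMZ
    rw [← heq]
    refine Subgroup.commutator_le.mpr fun p _ q _ => ?_
    obtain ⟨m, hm, c, hc, rfl⟩ := hdec p
    obtain ⟨n, hn, d, hd, rfl⟩ := hdec q
    have hc' := Subgroup.mem_center_iff.mp hc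
    have hd' := Subgroup.mem_center_iff.mp hd
    have h3 : ⁅m * c, n * d⁆ = ⁅m, n⁆ := by
      have e1 : (m * c) * (n * d) = (m * n) * (c * d) := by
        rw [mul_assoc, ← mul_assoc c n d, ← hc' n]; simp only [mul_assoc]
      have e2 : (n * d) * (m * c) = (n * m) * (c * d) := by
        rw [mul_assoc, ← mul_assoc d m c, ← hd' m, mul_assoc m d c, ← hd' c]; simp only [mul_assoc]
      have e3 : ∀ a b : P, ⁅a, b⁆ = (a * b) * (b * a)⁻¹ := fun a b => by
        rw [commutatorElement_def]; group
      rw [e3, e3, e1, e2]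
      group
    rw [h3]
    exact M.mul_mem (M.mul_mem (M.mul_mem hm hn) (M.inv_mem hm)) (M.inv_mem hn)

/-- Commuting embeddings of `H` and `K` that together generate `P` and identify the centers exhibit
`P` as a central product. -/
theorem isCentralProductOf_of_homs {P H K : Type*} [Group P] [Group H] [Group K] (i : H →* P)
    (j : K →* P) (hi : Function.Injective i) (hj : Function.Injective j)
    (hcomm : ∀ h k, i h * j k = j k * i h) (hgen : ∀ p, ∃ h k, i h * j k = p)
    (hH : ∀ h ∈ Subgroup.center H, ∃ k, j k = i h)
    (hK : ∀ k ∈ Subgroup.center K, ∃ h, i h = j k) : IsCentralProductOf P H K := by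
  refine ⟨i.range, j.range, ⟨(MonoidHom.ofInjective hi).symm⟩, ⟨(MonoidHom.ofInjective hj).symm⟩,
    ?_, ?_, ?_, ?_⟩
  · rintro _ ⟨h, rfl⟩ _ ⟨k, rfl⟩
    exact hcomm h k
  · refine Subgroup.eq_top_iff' _ |>.mpr fun p => ?_
    obtain ⟨h, k, rfl⟩ := hgen p
    exact mul_mem (Subgroup.mem_sup_left ⟨h, rfl⟩) (Subgroup.mem_sup_right ⟨k, rfl⟩)
  · ext p
    constructor
    · rintro ⟨⟨h, rfl⟩, ⟨k, hk⟩⟩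
      refine ⟨⟨i h, h, rfl⟩, Subgroup.mem_center_iff.mpr ?_, rfl⟩
      rintro ⟨_, h', rfl⟩
      exact Subtype.ext (by change i h' * i h = i h * i h'; rw [← hk, hcomm])
    · rintro ⟨⟨_, h, rfl⟩, hc, rfl⟩
      have hh : h ∈ Subgroup.center H := Subgroup.mem_center_iff.mpr fun h' => hi (by
        rw [map_mul, map_mul]
        exact congrArg Subtype.val (Subgroup.mem_center_iff.mp hc ⟨i h', h', rfl⟩))
      exact ⟨⟨h, rfl⟩, hH h hh⟩
  · ext p
    constructor
    · rintro ⟨⟨h, hh⟩, ⟨k, rfl⟩⟩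
      refine ⟨⟨j k, k, rfl⟩, Subgroup.mem_center_iff.mpr ?_, rfl⟩
      rintro ⟨_, k', rfl⟩
      exact Subtype.ext (by change j k' * j k = j k * j k'; rw [← hh, hcomm])
    · rintro ⟨⟨_, k, rfl⟩, hc, rfl⟩
      have hk : k ∈ Subgroup.center K := Subgroup.mem_center_iff.mpr fun k' => hj (by
        rw [map_mul, map_mul]
        exact congrArg Subtype.val (Subgroup.mem_center_iff.mp hc ⟨j k', k', rfl⟩))
      exact ⟨hK k hk, ⟨k, rfl⟩⟩

/-- A normal nilpotent subgroup lies in `Q` if commutators with elements outside `Q` preserve some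
nonempty set not containing `1`: iterated commutators would otherwise never become trivial. -/
theorem Subgroup.le_of_isNilpotent_of_commutator_mem {G : Type*} [Group G] {Q N : Subgroup G}
    (S : Set G) (h1 : 1 ∉ S) (hS : S.Nonempty) (hQ : ∀ g ∉ Q, ∀ c ∈ S, ⁅c, g⁆ ∈ S)
    (hN : N.Normal) (hnil : Group.IsNilpotent N) : N ≤ Q := by
  by_contra hNQ
  obtain ⟨g, hgN, hgQ⟩ := SetLike.not_le_iff_exists.mp hNQ
  have key : ∀ n, ∃ c ∈ S, c ∈ N.lowerCentralSeries n := by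
    intro n
    induction n with
    | zero =>
      obtain ⟨s, hs⟩ := hS
      refine ⟨_, hQ g hgQ s hs, ?_⟩
      exact N.mul_mem (hN.conj_mem g hgN s) (N.inv_mem hgN)
    | succ n ih =>
      obtain ⟨c, hcS, hc⟩ := ih
      exact ⟨_, hQ g hgQ c hcS, Subgroup.commutator_mem_commutator hc hgN⟩
  obtain ⟨n, hn⟩ := (Subgroup.isNilpotent_iff_lowerCentralSeries N).mp hnil
  obtain ⟨c, hcS, hc⟩ := key n
  rw [hn, Subgroup.mem_bot] at hc
  exact h1 (hc ▸ hcS)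

theorem fittingSubgroup_eq_top_of_isNilpotent {G : Type*} [Group G] (h : Group.IsNilpotent G) :
    fittingSubgroup G = ⊤ :=
  top_le_iff.mp (le_sSup ⟨inferInstance, Group.isNilpotent_top.mpr h⟩)

end

/-! ### The even monomials in a Clifford algebra -/

section

open scoped commutatorElement

/-- The extraspecial group of signed even monomials `± e_S`, `S ⊆ {1, …, 5}` with `|S|` even, in the
Clifford algebra on five generators. The even set `S` is recorded by its first four indicator
coordinates `x₁, …, x₄`, the fifth being their sum; the sign of each monomial is normalised so that
the cyclic shift of the five generators fixes the signs. -/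
@[ext]
structure EvenClifford where
  sgn : ZMod 2
  x₁ : ZMod 2
  x₂ : ZMod 2
  x₃ : ZMod 2
  x₄ : ZMod 2
  deriving DecidableEq, Fintype

namespace EvenClifford

/-- The fifth indicator coordinate. -/
def x₅ (v : EvenClifford) : ZMod 2 := v.x₁ + v.x₂ + v.x₃ + v.x₄

/-- The cocycle `∑ vᵢ (wᵢ₊₁ + wᵢ₊₂)`, indices modulo `5`: it is invariant under the cyclic shift and
restricts on the diagonal to `|S| / 2`, which governs the squares of the monomials. -/
def cocycle (v w : EvenClifford) : ZMod 2 :=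
  v.x₁ * (w.x₂ + w.x₃) + v.x₂ * (w.x₃ + w.x₄) + v.x₃ * (w.x₄ + w.x₅) + v.x₄ * (w.x₅ + w.x₁) +
    v.x₅ * (w.x₁ + w.x₂)

instance : Mul EvenClifford := ⟨fun v w =>
  ⟨v.sgn + w.sgn + cocycle v w, v.x₁ + w.x₁, v.x₂ + w.x₂, v.x₃ + w.x₃, v.x₄ + w.x₄⟩⟩

instance : One EvenClifford := ⟨⟨0, 0, 0, 0, 0⟩⟩

instance : Inv EvenClifford := ⟨fun v => ⟨-v.sgn + cocycle v v, -v.x₁, -v.x₂, -v.x₃, -v.x₄⟩⟩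

theorem mul_def (v w : EvenClifford) : v * w =
    ⟨v.sgn + w.sgn + cocycle v w, v.x₁ + w.x₁, v.x₂ + w.x₂, v.x₃ + w.x₃, v.x₄ + w.x₄⟩ := rfl

theorem one_def : (1 : EvenClifford) = ⟨0, 0, 0, 0, 0⟩ := rfl

theorem inv_def (v : EvenClifford) :
    v⁻¹ = ⟨-v.sgn + cocycle v v, -v.x₁, -v.x₂, -v.x₃, -v.x₄⟩ := rfl

instance : Group EvenClifford := Group.ofLeftAxioms
  (fun u v w => by
    simp only [mul_def, cocycle, x₅, EvenClifford.mk.injEq]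
    refine ⟨?_, ?_, ?_, ?_, ?_⟩ <;> ring)
  (fun v => by simp [mul_def, one_def, cocycle, x₅])
  (fun v => by
    simp only [mul_def, one_def, inv_def, cocycle, x₅, EvenClifford.mk.injEq]
    refine ⟨?_, ?_, ?_, ?_, ?_⟩ <;> ring)

/-- The automorphism induced by the cyclic shift of the five generators. -/
def shift : MulAut EvenClifford where
  toFun v := ⟨v.sgn, v.x₅, v.x₁, v.x₂, v.x₃⟩
  invFun v := ⟨v.sgn, v.x₂, v.x₃, v.x₄, v.x₅⟩
  left_inv := by decide +kernel
  right_inv := by decide +kernel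
  map_mul' := by decide +kernel

theorem shift_pow_five : shift ^ 5 = 1 :=
  MulEquiv.ext (by decide +kernel)

/-- The action of the cyclic group of order five by powers of the cyclic shift. -/
def shiftHom : Multiplicative (ZMod 5) →* MulAut EvenClifford := zmodPowersHom shift shift_pow_five

theorem mem_center_iff (v : EvenClifford) :
    v ∈ Subgroup.center EvenClifford ↔ v.x₁ = 0 ∧ v.x₂ = 0 ∧ v.x₃ = 0 ∧ v.x₄ = 0 := by
  rw [Subgroup.mem_center_iff]
  revert v
  decide +kernel

theorem card_center : Nat.card (Subgroup.center EvenClifford) = 2 := by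
  let e : Subgroup.center EvenClifford ≃ ZMod 2 :=
    { toFun := fun v => v.1.sgn
      invFun := fun s => ⟨⟨s, 0, 0, 0, 0⟩, (mem_center_iff _).mpr ⟨rfl, rfl, rfl, rfl⟩⟩
      left_inv := fun v => by
        obtain ⟨h1, h2, h3, h4⟩ := (mem_center_iff _).mp v.2
        exact Subtype.ext (EvenClifford.ext rfl h1.symm h2.symm h3.symm h4.symm)
      right_inv := fun s => rfl }
  rw [Nat.card_congr e, Nat.card_zmod]

theorem commutator_mem_center (v w : EvenClifford) : ⁅v, w⁆ ∈ Subgroup.center EvenClifford := by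
  rw [mem_center_iff]
  simp only [commutatorElement_def, mul_def, inv_def]
  refine ⟨?_, ?_, ?_, ?_⟩ <;> ring

theorem isPGroup : IsPGroup 2 EvenClifford :=
  IsPGroup.of_card (n := 5) (by rw [Nat.card_eq_fintype_card]; decide +kernel)

theorem card : Nat.card EvenClifford = 32 := by
  rw [Nat.card_eq_fintype_card]
  decide +kernel

/-- The quaternion subgroup generated by `e₁ e₂` and `e₂ e₃`. -/
def ofQuaternion : QuaternionGroup 2 →* EvenClifford :=
  MonoidHom.mk'
    (fun
      | .a i => ⟨0, 1, 1, 0, 0⟩ ^ i.val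
      | .xa i => ⟨0, 0, 1, 1, 0⟩ * ⟨0, 1, 1, 0, 0⟩ ^ i.val)
    (by decide +kernel)

/-- The dihedral subgroup generated by `e₄ e₅` and `e₁ e₂ e₃ e₄`. -/
def ofDihedral : DihedralGroup 4 →* EvenClifford :=
  MonoidHom.mk'
    (fun
      | .r i => ⟨0, 0, 0, 0, 1⟩ ^ i.val
      | .sr i => ⟨0, 1, 1, 1, 1⟩ * ⟨0, 0, 0, 0, 1⟩ ^ i.val)
    (by decide +kernel)

theorem isExtraspecial_of_mulEquiv {P : Type*} [Group P] (e : EvenClifford ≃* P) :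
    IsExtraspecial 2 P := by
  have : Finite P := Finite.of_equiv _ e.toEquiv
  refine isExtraspecial_two (isPGroup.of_equiv e) ?_ (fun x y => ?_) ?_
  · rw [← Nat.card_congr (Subgroup.centerCongr e).toEquiv, card_center]
  · rw [Subgroup.mem_center_iff]
    intro z
    have h := Subgroup.mem_center_iff.mp (commutator_mem_center (e.symm x) (e.symm y)) (e.symm z)
    apply e.symm.injective
    rw [map_mul, map_mul, map_commutatorElement]
    exact h
  · refine ⟨e ⟨0, 1, 1, 0, 0⟩, e ⟨0, 0, 1, 1, 0⟩, ?_⟩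
    rw [← map_mul, ← map_mul, e.injective.ne_iff]
    decide

theorem isCentralProductOf_of_mulEquiv {P : Type*} [Group P] (e : EvenClifford ≃* P) :
    IsCentralProductOf P (QuaternionGroup 2) (DihedralGroup 4) := by
  refine isCentralProductOf_of_homs (e.toMonoidHom.comp ofQuaternion)
    (e.toMonoidHom.comp ofDihedral) (e.injective.comp ?_) (e.injective.comp ?_) ?_ ?_ ?_ ?_
  · unfold Function.Injective
    decide +kernel
  · unfold Function.Injective
    decide +kernel
  · have : ∀ h k, ofQuaternion h * ofDihedral k = ofDihedral k * ofQuaternion h := by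
      decide +kernel
    intro h k
    change e _ * e _ = e _ * e _
    rw [← map_mul, this, map_mul]
  · have : ∀ v, ∃ h k, ofQuaternion h * ofDihedral k = v := by decide +kernel
    intro p
    obtain ⟨h, k, hhk⟩ := this (e.symm p)
    refine ⟨h, k, ?_⟩
    change e _ * e _ = p
    rw [← map_mul, hhk, e.apply_symm_apply]
  · have : ∀ h, (∀ h', h' * h = h * h') → ∃ k, ofDihedral k = ofQuaternion h := by decide +kernel
    intro h hh
    obtain ⟨k, hk⟩ := this h (Subgroup.mem_center_iff.mp hh)
    exact ⟨k, congrArg e hk⟩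
  · have : ∀ k, (∀ k', k' * k = k * k') → ∃ h, ofQuaternion h = ofDihedral k := by decide +kernel
    intro k hk
    obtain ⟨h, hh⟩ := this k (Subgroup.mem_center_iff.mp hk)
    exact ⟨h, congrArg e hh⟩

/-- A group containing the group of even monomials as a normal subgroup with cyclic quotient of
order five acting without fixed points modulo the center has that subgroup as its Fitting
subgroup, and equals its second Fitting subgroup. -/
theorem isDegreeNineQuotient_of_hom {K : Type*} [Group K] (i : EvenClifford →* K)
    (hi : Function.Injective i) (r : K →* Multiplicative (ZMod 5)) (hr : Function.Surjective r)
    (hker : r.ker = i.range)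
    (hact : ∀ g, r g ≠ 1 → ∀ v ∉ Subgroup.center EvenClifford,
      ∃ w ∉ Subgroup.center EvenClifford, ⁅i v, g⁆ = i w) : IsDegreeNineQuotient K := by
  have hnorm : i.range.Normal := hker ▸ r.normal_ker
  have hF : fittingSubgroup K = i.range := by
    refine le_antisymm (sSup_le fun N hN => ?_) (le_sSup ⟨hnorm, ?_⟩)
    · refine Subgroup.le_of_isNilpotent_of_commutator_mem
        {x | ∃ v ∉ Subgroup.center EvenClifford, i v = x} ?_ ?_ ?_ hN.1 hN.2
      · rintro ⟨v, hv, h1⟩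
        rw [← map_one i] at h1
        exact hv (hi h1 ▸ one_mem _)
      · exact ⟨_, ⟨0, 1, 0, 0, 0⟩, by simp [mem_center_iff], rfl⟩
      · rintro g hg _ ⟨v, hv, rfl⟩
        obtain ⟨w, hw, h⟩ := hact g (fun h1 => hg (hker ▸ h1)) v hv
        exact ⟨w, hw, h.symm⟩
    · have h2 : IsPGroup 2 i.range := isPGroup.of_equiv (MonoidHom.ofInjective hi)
      have : Finite i.range := Finite.of_equiv _ (MonoidHom.ofInjective hi).toEquiv
      exact h2.isNilpotent
  let e : EvenClifford ≃* fittingSubgroup K :=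
    (MonoidHom.ofInjective hi).trans (MulEquiv.subgroupCongr hF.symm)
  have hcomm : Group.IsNilpotent (K ⧸ fittingSubgroup K) := by
    have habel : ∀ x y : K ⧸ fittingSubgroup K, x * y = y * x := fun x y => by
      obtain ⟨x, rfl⟩ := QuotientGroup.mk_surjective x
      obtain ⟨y, rfl⟩ := QuotientGroup.mk_surjective y
      rw [← QuotientGroup.mk_mul, ← QuotientGroup.mk_mul, QuotientGroup.eq, hF, ← hker,
        MonoidHom.mem_ker, map_mul, map_inv, map_mul, map_mul, mul_comm (r x), inv_mul_cancel]
    exact @CommGroup.isNilpotent _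
      { (inferInstance : Group (K ⧸ fittingSubgroup K)) with mul_comm := habel }
  have hF2 : secondFittingSubgroup K = ⊤ := by
    rw [secondFittingSubgroup, fittingSubgroup_eq_top_of_isNilpotent hcomm, Subgroup.comap_top]
  refine ⟨?_, isExtraspecial_of_mulEquiv e, isCentralProductOf_of_mulEquiv e, ?_, 1, ?_⟩
  · rw [← Nat.card_congr e.toEquiv, card]
    rfl
  · rw [hF2, Subgroup.relIndex_top_right, hF, ← hker, Subgroup.index_ker,
      MonoidHom.range_eq_top.mpr hr, Subgroup.card_top]
    simp
  · intro x y _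
    obtain ⟨x, rfl⟩ := QuotientGroup.mk_surjective x
    obtain ⟨y, rfl⟩ := QuotientGroup.mk_surjective y
    rw [QuotientGroup.eq, hF2]
    trivial

end EvenClifford

/-- The solvable group of order `160`: the even monomials extended by the cyclic shift. -/
abbrev CliffordShiftGroup : Type := EvenClifford ⋊[EvenClifford.shiftHom] Multiplicative (ZMod 5)

namespace CliffordShiftGroup

open EvenClifford

theorem commutator_inl (v : EvenClifford) (g : CliffordShiftGroup) :
    ⁅(SemidirectProduct.inl v : CliffordShiftGroup), g⁆ =
      SemidirectProduct.inl (v * (g.left * shiftHom g.right v⁻¹ * g.left⁻¹)) := by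
  ext1 <;> simp [commutatorElement_def, mul_assoc]

theorem isDegreeNineQuotient_of_mulEquiv {K : Type*} [Group K] (e : K ≃* CliffordShiftGroup) :
    IsDegreeNineQuotient K := by
  refine isDegreeNineQuotient_of_hom (e.symm.toMonoidHom.comp SemidirectProduct.inl)
    (e.symm.injective.comp SemidirectProduct.inl_injective)
    (SemidirectProduct.rightHom.comp e.toMonoidHom)
    (SemidirectProduct.rightHom_surjective.comp e.surjective) ?_ ?_
  · ext g
    rw [MonoidHom.mem_ker]
    change e g ∈ SemidirectProduct.rightHom.ker ↔ _
    rw [← SemidirectProduct.range_inl_eq_ker_rightHom]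
    constructor
    · rintro ⟨v, hv⟩
      exact ⟨v, e.symm_apply_eq.mpr hv⟩
    · rintro ⟨v, hv⟩
      exact ⟨v, e.symm_apply_eq.mp hv⟩
  · intro g hg v hv
    -- The shift has no nonzero fixed vectors on the even sets.
    have hfix : ∀ k : Multiplicative (ZMod 5), k ≠ 1 → ∀ v : EvenClifford,
        v.x₁ + (shiftHom k v⁻¹).x₁ = 0 ∧ v.x₂ + (shiftHom k v⁻¹).x₂ = 0 ∧
        v.x₃ + (shiftHom k v⁻¹).x₃ = 0 ∧ v.x₄ + (shiftHom k v⁻¹).x₄ = 0 →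
        v.x₁ = 0 ∧ v.x₂ = 0 ∧ v.x₃ = 0 ∧ v.x₄ = 0 := by
      decide +kernel
    refine ⟨v * ((e g).left * shiftHom (e g).right v⁻¹ * (e g).left⁻¹), fun hc => hv ?_, ?_⟩
    · rw [mem_center_iff] at hc ⊢
      simp only [EvenClifford.mul_def, EvenClifford.inv_def (e g).left] at hc
      obtain ⟨h₁, h₂, h₃, h₄⟩ := hc
      exact hfix (e g).right hg v ⟨by linear_combination h₁, by linear_combination h₂,
        by linear_combination h₃, by linear_combination h₄⟩
    · apply e.injective
      rw [map_commutatorElement]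
      change ⁅e (e.symm _), e g⁆ = e (e.symm _)
      rw [e.apply_symm_apply, e.apply_symm_apply, commutator_inl]

end CliffordShiftGroup

end

/-! ### The spin representation over `𝔽₃` in degree nine -/

section

open Matrix

/-- The permutation action of the invertible matrices on column vectors. -/
def Matrix.unitsPerm (n R : Type*) [Fintype n] [DecidableEq n] [CommRing R] :
    (Matrix n n R)ˣ →* Equiv.Perm (n → R) where
  toFun M :=
    { toFun := fun v => M.1 *ᵥ v
      invFun := fun v => M⁻¹.1 *ᵥ v
      left_inv := fun v => (mulVec_mulVec v _ _).trans (by rw [Units.inv_mul, one_mulVec])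
      right_inv := fun v => (mulVec_mulVec v _ _).trans (by rw [Units.mul_inv, one_mulVec]) }
  map_one' := Equiv.ext one_mulVec
  map_mul' M N := Equiv.ext fun v => (mulVec_mulVec v M.1 N.1).symm

theorem Matrix.unitsPerm_apply {n R : Type*} [Fintype n] [DecidableEq n] [CommRing R]
    (M : (Matrix n n R)ˣ) (v : n → R) : unitsPerm n R M v = M.1 *ᵥ v := rfl

theorem Matrix.unitsPerm_injective (n R : Type*) [Fintype n] [DecidableEq n] [CommRing R] :
    Function.Injective (unitsPerm n R) := fun _ _ h =>
  Units.ext (Matrix.toLin'.injective (LinearMap.ext fun v => DFunLike.congr_fun h v))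

namespace EvenClifford

/-- The monomials `e₁e₅`, `e₂e₅`, `e₃e₅`, `e₄e₅` up to sign. -/
def gen : Fin 4 → EvenClifford :=
  ![⟨0, 1, 0, 0, 0⟩, ⟨0, 0, 1, 0, 0⟩, ⟨0, 0, 0, 1, 0⟩, ⟨0, 0, 0, 0, 1⟩]

/-- The four monomials generate the group, already as a monoid. -/
theorem eq_top_of_gen_mem {S : Submonoid EvenClifford} (hS : ∀ i, gen i ∈ S) : S = ⊤ := by
  have key : ∀ v, ∃ (a : Fin 4) (b c d : Fin 2),
      gen 0 ^ a.1 * gen 1 ^ b.1 * gen 2 ^ c.1 * gen 3 ^ d.1 = v := by decide +kernel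
  refine (Submonoid.eq_top_iff' S).mpr fun v => ?_
  obtain ⟨a, b, c, d, rfl⟩ := key v
  exact mul_mem (mul_mem (mul_mem (pow_mem (hS 0) _) (pow_mem (hS 1) _)) (pow_mem (hS 2) _))
    (pow_mem (hS 3) _)

/-- Matrices over `𝔽₃` representing the generators. With `I`, `J`, `K` anticommuting of squares
`-1` and `P`, `Q` anticommuting of squares `1`, all of size two, these are the Kronecker products
`I ⊗ 1`, `J ⊗ 1`, `K ⊗ P`, `K ⊗ Q`. -/
def spinGen : Fin 4 → Matrix (Fin 4) (Fin 4) (ZMod 3) :=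
  ![!![0, 0, 1, 0; 0, 0, 0, 1; 2, 0, 0, 0; 0, 2, 0, 0],
    !![1, 0, 1, 0; 0, 1, 0, 1; 1, 0, 2, 0; 0, 1, 0, 2],
    !![1, 0, 2, 0; 0, 2, 0, 1; 2, 0, 2, 0; 0, 1, 0, 1],
    !![0, 1, 0, 2; 1, 0, 2, 0; 0, 2, 0, 2; 2, 0, 2, 0]]

/-- The underlying function of the spin representation: the exponent of the sign compares the
shift-invariant cocycle with the one of normally ordered products of the generators. -/
def spinFun (v : EvenClifford) : Matrix (Fin 4) (Fin 4) (ZMod 3) :=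
  (-1) ^ (v.sgn + v.x₁ * v.x₃ + v.x₂ * v.x₃ + v.x₂ * v.x₄).val •
    (spinGen 0 ^ v.x₁.val * spinGen 1 ^ v.x₂.val * spinGen 2 ^ v.x₃.val * spinGen 3 ^ v.x₄.val)

theorem spinFun_one : spinFun 1 = 1 := by decide +kernel

theorem spinFun_mul (v w : EvenClifford) : spinFun (v * w) = spinFun v * spinFun w := by
  let S : Submonoid EvenClifford :=
    { carrier := {v | ∀ w, spinFun (v * w) = spinFun v * spinFun w}
      one_mem' := fun w => by rw [spinFun_one, one_mul, one_mul]
      mul_mem' := fun {v v'} hv hv' w => by rw [mul_assoc, hv, hv', hv, mul_assoc] }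
  have hS : S = ⊤ := eq_top_of_gen_mem (by
    change ∀ i w, spinFun (gen i * w) = spinFun (gen i) * spinFun w
    decide +kernel)
  exact (hS ▸ Submonoid.mem_top v : v ∈ S) w

/-- The spin representation of degree four over `𝔽₃`. -/
def spin : EvenClifford →* Matrix (Fin 4) (Fin 4) (ZMod 3) where
  toFun := spinFun
  map_one' := spinFun_one
  map_mul' := spinFun_mul

/-- A matrix inducing the cyclic shift on the image of the spin representation. -/
def spinShift : (Matrix (Fin 4) (Fin 4) (ZMod 3))ˣ :=
  ⟨!![0, 0, 2, 1; 1, 1, 0, 0; 2, 1, 2, 1; 1, 1, 2, 2],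
    !![0, 0, 2, 1; 1, 1, 0, 0; 2, 1, 2, 1; 1, 1, 2, 2] ^ 4, by decide +kernel, by decide +kernel⟩

theorem spinShift_pow_five : spinShift ^ 5 = 1 := Units.ext (by
  rw [Units.val_pow_eq_pow_val]
  decide +kernel)

theorem spin_shift_mul (v : EvenClifford) :
    spin (shift v) * spinShift.1 = spinShift.1 * spin v := by
  let S : Submonoid EvenClifford :=
    { carrier := {v | spin (shift v) * spinShift.1 = spinShift.1 * spin v}
      one_mem' := by simp
      mul_mem' := fun {v w} (hv : _ = _) (hw : _ = _) => by
        change _ = _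
        rw [map_mul, map_mul, map_mul, mul_assoc, hw, ← mul_assoc, hv, mul_assoc] }
  have hS : S = ⊤ := eq_top_of_gen_mem (by
    change ∀ i, spinFun (shift (gen i)) * spinShift.1 = spinShift.1 * spinFun (gen i)
    decide +kernel)
  exact (hS ▸ Submonoid.mem_top v : v ∈ S)

theorem spin_shift_pow_mul (n : ℕ) (v : EvenClifford) :
    spin ((shift ^ n) v) * spinShift.1 ^ n = spinShift.1 ^ n * spin v := by
  induction n with
  | zero => simp
  | succ n ih =>
    rw [pow_succ' shift, MulAut.mul_apply, pow_succ', ← mul_assoc, spin_shift_mul, mul_assoc, ih,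
      mul_assoc]

/-- The alternating form preserved by the spin representation. -/
def spinForm : Matrix (Fin 4) (Fin 4) (ZMod 3) :=
  !![0, 0, 1, 0; 0, 0, 0, 1; 2, 0, 0, 0; 0, 2, 0, 0]

/-- The matrices that preserve the form. -/
def spinIsometries : Submonoid (Matrix (Fin 4) (Fin 4) (ZMod 3)) where
  carrier := {M | Mᵀ * spinForm * M = spinForm}
  one_mem' := by simp
  mul_mem' := fun {M N} (hM : _ = _) (hN : _ = _) => by
    change _ = _
    rw [Matrix.transpose_mul, ← mul_assoc, mul_assoc Nᵀ, mul_assoc Nᵀ, hM, hN]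

theorem spin_mem_spinIsometries (v : EvenClifford) : spin v ∈ spinIsometries := by
  have : spinIsometries.comap spin = ⊤ := eq_top_of_gen_mem (by
    change ∀ i, (spinFun (gen i))ᵀ * spinForm * spinFun (gen i) = spinForm
    decide +kernel)
  exact (this ▸ Submonoid.mem_top v : v ∈ spinIsometries.comap spin)

theorem spinShift_mem_spinIsometries : spinShift.1 ∈ spinIsometries := by
  change spinShift.1ᵀ * spinForm * spinShift.1 = spinForm
  decide +kernel

end EvenClifford

namespace CliffordShiftGroup

open EvenClifford

/-- The spin representation, extended to the cyclic shift. -/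
def spin : CliffordShiftGroup →* (Matrix (Fin 4) (Fin 4) (ZMod 3))ˣ :=
  SemidirectProduct.lift EvenClifford.spin.toHomUnits (zmodPowersHom spinShift spinShift_pow_five)
    fun k => MonoidHom.ext fun v => by
      change _ = spinShift ^ k.toAdd.val * EvenClifford.spin.toHomUnits v *
        (spinShift ^ k.toAdd.val)⁻¹
      rw [eq_mul_inv_iff_mul_eq]
      apply Units.ext
      rw [Units.val_mul, Units.val_mul, Units.val_pow_eq_pow_val]
      exact spin_shift_pow_mul _ v

theorem spin_val (g : CliffordShiftGroup) :
    (spin g).1 = EvenClifford.spin g.left * spinShift.1 ^ g.right.toAdd.val := by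
  rw [← Units.val_pow_eq_pow_val]
  rfl

theorem spin_injective : Function.Injective spin := by
  have key : ∀ (v : EvenClifford) (k : ZMod 5), spinFun v * spinShift.1 ^ k.val = 1 →
      v = 1 ∧ k = 0 := by decide +kernel
  refine (injective_iff_map_eq_one _).mpr fun g hg => ?_
  obtain ⟨h1, h2⟩ := key g.left g.right.toAdd ((spin_val g).symm.trans (congrArg Units.val hg))
  exact SemidirectProduct.ext h1 h2

theorem spin_mem_spinIsometries (g : CliffordShiftGroup) : (spin g).1 ∈ spinIsometries := by
  rw [spin_val]
  exact mul_mem (EvenClifford.spin_mem_spinIsometries _) (pow_mem spinShift_mem_spinIsometries _)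

/-- The orbit of the first basis vector consists of all `80` nonzero vectors. -/
theorem exists_spin_apply (w : Fin 4 → ZMod 3) (hw : w ≠ 0) :
    ∃ g, unitsPerm _ _ (spin g) ![1, 0, 0, 0] = w := by
  have key : ∀ w : Fin 4 → ZMod 3, w ≠ 0 → ∃ (k : ZMod 5) (v : EvenClifford),
      spinShift.1 ^ k.val *ᵥ (spinFun v *ᵥ ![1, 0, 0, 0]) = w := by decide +kernel
  obtain ⟨k, v, h⟩ := key w hw
  refine ⟨SemidirectProduct.inr (Multiplicative.ofAdd k) * SemidirectProduct.inl v, ?_⟩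
  rw [map_mul, map_mul, Equiv.Perm.mul_apply, spin, SemidirectProduct.lift_inl,
    SemidirectProduct.lift_inr]
  refine Eq.trans ?_ h
  change (spinShift ^ k.val).1 *ᵥ _ = _
  rw [Units.val_pow_eq_pow_val]
  rfl

instance : Finite CliffordShiftGroup := Finite.of_equiv _ SemidirectProduct.equivProd.symm

instance : Group.IsSolvable CliffordShiftGroup := by
  have := EvenClifford.isPGroup.isNilpotent
  exact Group.isSolvable_of_ker_le_range (SemidirectProduct.inl : EvenClifford →* _)
    (SemidirectProduct.rightHom : CliffordShiftGroup →* _)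
    SemidirectProduct.range_inl_eq_ker_rightHom.ge

/-- The character `(a, b) ↦ exp (2πi (a + b) / 3)` of the ring `𝔽₃ × 𝔽₃`. -/
noncomputable def char : AddChar (ZMod 3 × ZMod 3) ℂ :=
  (ZMod.stdAddChar (N := 3)).compAddMonoidHom
    (AddMonoidHom.fst (ZMod 3) (ZMod 3) + AddMonoidHom.snd (ZMod 3) (ZMod 3))

theorem char_apply (a : ZMod 3 × ZMod 3) : char a = ZMod.stdAddChar (a.1 + a.2) := rfl

theorem isPrimitive_char : char.IsPrimitive := by
  intro a ha h
  have key : ∀ x, (a * x).1 + (a * x).2 = 0 := fun x => by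
    apply ZMod.injective_stdAddChar
    rw [AddChar.map_zero_eq_one]
    exact DFunLike.congr_fun h x
  refine ha (Prod.ext ?_ ?_)
  · simpa using key (1, 0)
  · simpa using key (0, 1)

/-- Pairing of coordinates: it turns the alternating form on `𝔽₃⁴` into the determinant form over
`𝔽₃ × 𝔽₃`, followed by the sum of the components. -/
def pairing : (Fin 4 → ZMod 3) ≃+ (Fin 2 → ZMod 3 × ZMod 3) where
  toFun v := ![(v 0, v 1), (v 2, v 3)]
  invFun u := ![(u 0).1, (u 0).2, (u 1).1, (u 1).2]
  left_inv v := by ext i; fin_cases i <;> rfl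
  right_inv u := by ext i <;> fin_cases i <;> rfl
  map_add' v w := by ext i <;> fin_cases i <;> rfl

theorem weylCocycle_pairing (u v : Fin 4 → ZMod 3) :
    weylCocycle char (2, 2) (pairing u) (pairing v) =
      ZMod.stdAddChar (2 * (u ⬝ᵥ (spinForm *ᵥ v))) := by
  rw [weylCocycle_eq char (2, 2) (by decide), char_apply]
  congr 1
  simp only [pairing, spinForm, AddEquiv.coe_mk, Equiv.coe_fn_mk, dotProduct, Matrix.mulVec,
    Fin.sum_univ_four, Matrix.cons_val, Matrix.of_apply, Prod.fst_mul, Prod.snd_mul, Prod.fst_sub,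
    Prod.snd_sub]
  have h : (2 : ZMod 3) = -1 := by decide
  rw [h]
  ring

theorem dotProduct_spinForm_mulVec {M : Matrix (Fin 4) (Fin 4) (ZMod 3)} (hM : M ∈ spinIsometries)
    (u v : Fin 4 → ZMod 3) : (M *ᵥ u) ⬝ᵥ (spinForm *ᵥ (M *ᵥ v)) = u ⬝ᵥ (spinForm *ᵥ v) := by
  have h : Mᵀ * spinForm * M = spinForm := hM
  conv_rhs => rw [← h]
  rw [dotProduct_comm, Matrix.dotProduct_mulVec, ← Matrix.mulVec_transpose, dotProduct_comm,
    Matrix.mulVec_mulVec, Matrix.mulVec_mulVec, mul_assoc]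

theorem isWeylSystem :
    IsWeylSystem (fun u v => weylCocycle char (2, 2) (pairing u) (pairing v))
      (fun v => weylOp char (2, 2) (pairing v)) :=
  (isWeylSystem_weylOp char (2, 2) isPrimitive_char).comp_addEquiv pairing

theorem hasUnitaryLifts : IsWeylSystem.HasUnitaryLifts
    (fun v => weylOp char (2, 2) (pairing v)) ((unitsPerm _ _).comp spin) := by
  refine isWeylSystem.hasUnitaryLifts_of_cocycle_eq (fun g u v => ?_) (fun g u v => ?_)
  · simp only [MonoidHom.comp_apply, unitsPerm_apply, Matrix.mulVec_add]
  · rw [weylCocycle_pairing, weylCocycle_pairing, MonoidHom.comp_apply, unitsPerm_apply,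
      unitsPerm_apply, dotProduct_spinForm_mulVec (spin_mem_spinIsometries g)]

end CliffordShiftGroup

open CliffordShiftGroup in
/-- The Weyl operators over `𝔽₃ × 𝔽₃` have degree nine, and the spin representation embeds the
extension of the even monomials by the shift in the isometry group of their index group `𝔽₃⁴`. -/
theorem isRealized_nine : IsRealized 9 (fun G _ E _ => IsDegreeNineQuotient (G ⧸ E)) :=
  isRealized_of_isWeylSystem isWeylSystem ((unitsPerm _ _).comp spin)
    ((unitsPerm_injective _ _).comp spin_injective) hasUnitaryLifts
    (transitive_of_base _ ![1, 0, 0, 0] exists_spin_apply) (by simp) (by norm_num)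
    (isDegreeNineQuotient_of_mulEquiv (isWeylSystem.quotientKerEquiv hasUnitaryLifts))

end

theorem mainTheorem9 :
    -- (i)
    IsRealized 2 (fun G _ _ _ => Nonempty (G ⧸ Subgroup.center G ≃* alternatingGroup (Fin 4))) ∧
    IsRealized 2 (fun G _ _ _ => Nonempty (G ⧸ Subgroup.center G ≃* Equiv.Perm (Fin 4))) ∧
    -- (ii)
    IsRealized 3 (fun G _ E _ => Nonempty (G ⧸ E ≃* QuaternionGroup 2)) ∧
    IsRealized 3 (fun G _ E _ =>
      Nonempty (G ⧸ E ≃* Matrix.SpecialLinearGroup (Fin 2) (ZMod 3))) ∧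
    -- (iii)
    IsRealized 5 (fun G _ E _ =>
      Nonempty (G ⧸ E ≃* Matrix.SpecialLinearGroup (Fin 2) (ZMod 3))) ∧
    -- (iv)
    IsRealized 7 (fun G _ E _ => Nonempty (G ⧸ E ≃* TwistedGL23)) ∧
    -- (v)
    IsRealized 9 (fun G _ E _ => IsDegreeNineQuotient (G ⧸ E)) := by
  exact ⟨isRealized_two_alternating, isRealized_two_perm, isRealized_three_quaternion,
    isRealized_three_sl, isRealized_five_sl, isRealized_seven_twistedGL23, isRealized_nine⟩
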